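/- Let $K=GF(4)$, let $\zeta$ be a primitive element of $K$ (a generator of $K^\times$), and let $\Omega=\mathbb{P}^2(K)$ be the set of the 21 points $[x,y,z]$ of the projective plane over $K$. Let $u,v,w$ be three further points. The group $PSL_3(4)$ acts on the 24 points of $\Omega\cup\{u,v,w\}$ by its natural action (matrices acting on column vectors) on $\Omega$, fixing $u$, $v$ and $w$. The Mathieu group $M_{24}$ is the permutation group on these 24 points obtained by Witt's construction as $$M_{22}=\langle PSL_3(4),S_3\rangle,\qquad M_{23}=\langle M_{22},S_4\rangle,\qquad M_{24}=\langle M_{23},S_5\rangle,$$ where * $S_3$ interchanges $u$ and $[1,0,0]$, fixes $v,w$, and $S_3[x,y,z]=[x^2+yz,\,y^2,\,z^2]$ for $[x,y,z]\neq[1,0,0]$; * $S_4$ interchanges $u$ and $v$, fixes $w$, and $S_4[x,y,z]=[x^2,y^2,\zeta z^2]$; * $S_5$ interchanges $v$ and $w$, fixes $u$, and $S_5[x,y,z]=[x^2,y^2,z^2]$. Let $\mathfrak{s},\mathfrak{j},\mathfrak{t},\mathfrak{r}$ be the permutations induced, respectively, by the matrices $$\begin{pmatrix}1&1&0\\0&1&0\\0&0&1\end{pmatrix},\quad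 \begin{pmatrix}0&1&0\\1&0&0\\0&0&1\end{pmatrix},\quad \begin{pmatrix}0&0&1\\0&1&0\\1&0&0\end{pmatrix},\quad \begin{pmatrix}\zeta&0&0\\0&1&0\\0&0&\zeta^{-1}\end{pmatrix}$$ of $SL_3(4)$, and put $\mathfrak{u}=S_3$, $\mathfrak{v}=S_4$, $\mathfrak{w}=S_5$. Write $x^y=y^{-1}xy$. **Proposition.** The group $M_{24}$ is generated by $\mathfrak{s},\mathfrak{j},\mathfrak{t},\mathfrak{r},\mathfrak{u},\mathfrak{v},\mathfrak{w}$, and the following are defining relations for $M_{24}$ with respect to these generators (that is, the abstract group presented by seven symbols and these relations is isomorphic to $M_{24}$ via the map sending each symbol to the permutation of the same name): $$\mathfrak{s}^2=\mathfrak{j}^2=\mathfrak{t}^2=\mathfrak{r}^3=(\mathfrak{j}\mathfrak{r})^2=(\mathfrak{t}\mathfrak{r})^2=(\mathfrak{s}\mathfrak{r})^3=(\mathfrak{j}\mathfrak{s})^3=(\mathfrak{t}\mathfrak{j})^3=(\mathfrak{t}\mathfrak{s}\mathfrak{t}\mathfrak{j}\mathfrak{s})^3=1,$$ $$\mathfrak{t}\mathfrak{s}\mathfrak{t}\cdot\mathfrak{j}\mathfrak{r}\cdot\mathfrak{t}\mathfrak{s}\mathfrak{t}=\mathfrak{r}\mathfrak{s}\mathfrak{r}^{-1}\mathfrak{j}\mathfrak{r}\cdot\mathfrak{t}\mathfrak{s}\mathfrak{t}\cdot\mathfrak{r}\mathfrak{s}\mathfrak{r}^{-1}\mathfrak{j}\mathfrak{r}^{-1}\mathfrak{s}\mathfrak{r}^{-1};$$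 $$\mathfrak{u}^2=(\mathfrak{u}\mathfrak{s})^2=(\mathfrak{u}\mathfrak{j})^3=1,\quad \mathfrak{r}^{\mathfrak{u}}=\mathfrak{r}^{\mathfrak{j}},\quad \mathfrak{s}^{\mathfrak{t}\mathfrak{u}}=\mathfrak{s}\,\mathfrak{s}^{\mathfrak{t}},\quad \mathfrak{s}^{\mathfrak{j}\mathfrak{t}\mathfrak{u}}=\mathfrak{s}^{\mathfrak{j}\mathfrak{t}}\,\mathfrak{s}^{\mathfrak{t}\mathfrak{j}\mathfrak{t}};$$ $$\mathfrak{v}^2=(\mathfrak{v}\mathfrak{s})^2=(\mathfrak{v}\mathfrak{u})^3=(\mathfrak{v}\mathfrak{j})^2=(\mathfrak{v}\mathfrak{r})^2=1,\quad \mathfrak{s}^{\mathfrak{t}\mathfrak{v}}=\mathfrak{s}^{\mathfrak{t}\mathfrak{r}},\quad \mathfrak{s}^{\mathfrak{j}\mathfrak{t}\mathfrak{v}}=\mathfrak{s}^{\mathfrak{j}\mathfrak{t}\mathfrak{r}};$$ $$\mathfrak{w}^2=(\mathfrak{w}\mathfrak{r})^2=(\mathfrak{w}\mathfrak{s})^2=(\mathfrak{w}\mathfrak{j})^2=(\mathfrak{w}\mathfrak{u})^2=(\mathfrak{w}\mathfrak{s}^{\mathfrak{t}})^2=(\mathfrak{w}\mathfrak{s}^{\mathfrak{j}\mathfrak{t}})^2=(\mathfrak{w}\mathfrak{v})^3=1.$$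 -/

import Mathlib

open scoped LinearAlgebra.Projectivization

noncomputable section

namespace Mathieu

/-- The field `GF(4)`. -/
abbrev F4 : Type := GaloisField 2 2

/-- The points of the projective plane over `GF(4)`, in homogeneous coordinates `[x, y, z]`. -/
abbrev Plane : Type := ℙ F4 (Fin 3 → F4)

/-- The group `PSL_3(4)`. -/
abbrev PSL34 : Type := Matrix.ProjectiveSpecialLinearGroup (Fin 3) F4

/-- The three points adjoined to the projective plane. -/
inductive NewPoint : Type
  | u
  | v
  | w

/-- The 24 points: the projective plane together with the new points `u, v, w`. -/
abbrev Point24 : Type := Plane ⊕ NewPoint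

/-- A permutation of the plane, extended to the 24 points by fixing `u, v, w`. -/
def extendPerm : Equiv.Perm Plane →* Equiv.Perm Point24 :=
  (Equiv.Perm.sumCongrHom Plane NewPoint).comp (MonoidHom.inl _ _)

/-- The action of `PSL_3(4)` on the 24 points: the natural action of matrices on column vectors
on the plane, and the trivial action on `u, v, w`. -/
def pslHom : PSL34 →* Equiv.Perm Point24 :=
  extendPerm.comp Projectivization.PSLAction.toPermHom

/-! ### Permutations given by quadratic forms in the homogeneous coordinates -/

/-- The map `[v] ↦ [f v]` on the projective plane. -/
def coordMap (f : (Fin 3 → F4) → (Fin 3 → F4)) (hs : ∀ (a : F4) v, f (a • v) = a ^ 2 • f v)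
    (h0 : ∀ v, v ≠ 0 → f v ≠ 0) : Plane → Plane :=
  Projectivization.lift (fun v => Projectivization.mk F4 (f v.1) (h0 v.1 v.2)) (by
    rintro ⟨x, hx⟩ ⟨y, hy⟩ t h
    rw [Projectivization.mk_eq_mk_iff']
    refine ⟨t ^ 2, ?_⟩
    simp only at h ⊢
    rw [h, hs])

theorem ne_zero_of_involutive (f : (Fin 3 → F4) → (Fin 3 → F4))
    (hs : ∀ (a : F4) v, f (a • v) = a ^ 2 • f v) (hf : Function.Involutive f)
    (v : Fin 3 → F4) (hv : v ≠ 0) : f v ≠ 0 := by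
  intro h
  apply hv
  have h1 : f 0 = 0 := by simpa using hs 0 0
  rw [← hf v, h, h1]

/-- The permutation `[v] ↦ [f v]` of the plane, for an involutive map `f` of the coordinates. -/
def coordPerm (f : (Fin 3 → F4) → (Fin 3 → F4)) (hs : ∀ (a : F4) v, f (a • v) = a ^ 2 • f v)
    (hf : Function.Involutive f) : Equiv.Perm Plane :=
  Function.Involutive.toPerm (coordMap f hs (ne_zero_of_involutive f hs hf)) (by
    intro p
    induction p using Projectivization.ind with
    | _ v hv =>
      simp only [coordMap, Projectivization.lift_mk]
      congr 1
      exact hf v)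

theorem pow_four (x : F4) : x ^ 4 = x := by
  have h : Nat.card F4 = 4 := by simpa using GaloisField.card 2 2 (by norm_num)
  have : Fintype F4 := Fintype.ofFinite F4
  have h2 := FiniteField.pow_card x
  rwa [← Nat.card_eq_fintype_card, h] at h2

theorem add_self (x : F4) : x + x = 0 := CharTwo.add_self_eq_zero x

theorem unit_pow_three (a : F4ˣ) : (a : F4) ^ 3 = 1 := by
  have h := pow_four (a : F4)
  have h2 : (a : F4) * ((a : F4) ^ 3 - 1) = 0 := by linear_combination h
  rcases mul_eq_zero.1 h2 with h3 | h3
  · exact absurd h3 a.ne_zero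
  · linear_combination h3

/-- The permutation `[x, y, z] ↦ [x² + yz, y², z²]` of the plane. It fixes `[1, 0, 0]`. -/
def quadPerm : Equiv.Perm Plane :=
  coordPerm (fun p => ![p 0 ^ 2 + p 1 * p 2, p 1 ^ 2, p 2 ^ 2])
    (by
      intro a p
      ext i
      fin_cases i <;> simp <;> ring)
    (by
      intro p
      ext i
      fin_cases i <;> simp
      · linear_combination pow_four (p 0) + add_self (p 0 ^ 2 * (p 1 * p 2)) +
          add_self (p 1 ^ 2 * p 2 ^ 2)
      · linear_combination pow_four (p 1)
      · linear_combination pow_four (p 2))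

/-- The permutation `[x, y, z] ↦ [x², y², a z²]` of the plane. -/
def frobPerm (a : F4ˣ) : Equiv.Perm Plane :=
  coordPerm (fun p => ![p 0 ^ 2, p 1 ^ 2, a * p 2 ^ 2])
    (by
      intro a p
      ext i
      fin_cases i <;> simp <;> ring)
    (by
      intro p
      ext i
      fin_cases i <;> simp
      · linear_combination pow_four (p 0)
      · linear_combination pow_four (p 1)
      · linear_combination pow_four (p 2) + p 2 ^ 4 * unit_pow_three a)

/-! ### The generating permutations -/

/-- The point `[1, 0, 0]`. -/
def q2 : Plane := Projectivization.mk F4 ![1, 0, 0] (by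
  intro h
  simpa using congrFun h 0)

open Classical in
/-- `S₃` interchanges `[1, 0, 0]` and `u`, fixes `v` and `w`, and sends every other point
`[x, y, z]` to `[x² + yz, y², z²]`. -/
def S3 : Equiv.Perm Point24 :=
  Equiv.swap (Sum.inl q2) (Sum.inr NewPoint.u) * extendPerm quadPerm

open Classical in
/-- `S₄` interchanges `u` and `v`, fixes `w`, and sends `[x, y, z]` to `[x², y², ζ z²]`. -/
def S4 (ζ : F4ˣ) : Equiv.Perm Point24 :=
  Equiv.swap (Sum.inr NewPoint.u) (Sum.inr NewPoint.v) * extendPerm (frobPerm ζ)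

open Classical in
/-- `S₅` interchanges `v` and `w`, fixes `u`, and sends `[x, y, z]` to `[x², y², z²]`. -/
def S5 : Equiv.Perm Point24 :=
  Equiv.swap (Sum.inr NewPoint.v) (Sum.inr NewPoint.w) * extendPerm (frobPerm 1)

/-- The Mathieu group `M₂₂`, acting on the plane and `u` (and fixing `v`, `w`):
Witt's extension of `PSL_3(4)`. -/
def M22 : Subgroup (Equiv.Perm Point24) :=
  Subgroup.closure ((pslHom.range : Set (Equiv.Perm Point24)) ∪ {S3})

/-- The Mathieu group `M₂₃`, acting on the plane, `u` and `v` (and fixing `w`):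
Witt's extension of `M₂₂`. -/
def M23 (ζ : F4ˣ) : Subgroup (Equiv.Perm Point24) :=
  Subgroup.closure ((M22 : Set (Equiv.Perm Point24)) ∪ {S4 ζ})

/-- The Mathieu group `M₂₄`, a permutation group on the 24 points: Witt's extension of `M₂₃`. -/
def M24 (ζ : F4ˣ) : Subgroup (Equiv.Perm Point24) :=
  Subgroup.closure ((M23 ζ : Set (Equiv.Perm Point24)) ∪ {S5})

theorem neg_one_eq_one : (-1 : F4) = 1 := CharTwo.neg_eq 1

/-- The matrix inducing `𝔰`. -/
def matS : Matrix.SpecialLinearGroup (Fin 3) F4 :=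
  ⟨!![1, 1, 0; 0, 1, 0; 0, 0, 1], by simp [Matrix.det_fin_three]⟩

/-- The matrix inducing `𝔧`. -/
def matJ : Matrix.SpecialLinearGroup (Fin 3) F4 :=
  ⟨!![0, 1, 0; 1, 0, 0; 0, 0, 1], by simp [Matrix.det_fin_three, neg_one_eq_one]⟩

/-- The matrix inducing `𝔱`. -/
def matT : Matrix.SpecialLinearGroup (Fin 3) F4 :=
  ⟨!![0, 0, 1; 0, 1, 0; 1, 0, 0], by simp [Matrix.det_fin_three, neg_one_eq_one]⟩

/-- The matrix inducing `𝔯`. -/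
def matR (ζ : F4ˣ) : Matrix.SpecialLinearGroup (Fin 3) F4 :=
  ⟨!![(ζ : F4), 0, 0; 0, 1, 0; 0, 0, ((ζ⁻¹ : F4ˣ) : F4)], by simp [Matrix.det_fin_three]⟩

/-! ### The presentation -/

/-- The generating symbols `𝔰, 𝔧, 𝔱, 𝔯, 𝔲, 𝔳, 𝔴`. -/
inductive Gen : Type
  | s
  | j
  | t
  | r
  | u
  | v
  | w

/-- The permutations of the 24 points denoted by the generating symbols. -/
def genPerm (ζ : F4ˣ) : Gen → Equiv.Perm Point24
  | Gen.s => pslHom (matS : PSL34)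
  | Gen.j => pslHom (matJ : PSL34)
  | Gen.t => pslHom (matT : PSL34)
  | Gen.r => pslHom (matR ζ : PSL34)
  | Gen.u => S3
  | Gen.v => S4 ζ
  | Gen.w => S5

/-- The conjugate `x ^ y = y⁻¹ x y`. -/
def cj {G : Type*} [Group G] (x y : G) : G := y⁻¹ * x * y

def s : FreeGroup Gen := FreeGroup.of Gen.s
def j : FreeGroup Gen := FreeGroup.of Gen.j
def t : FreeGroup Gen := FreeGroup.of Gen.t
def r : FreeGroup Gen := FreeGroup.of Gen.r
def u : FreeGroup Gen := FreeGroup.of Gen.u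
def v : FreeGroup Gen := FreeGroup.of Gen.v
def w : FreeGroup Gen := FreeGroup.of Gen.w

/-- The relators for `PSL_3(4)`; a relation `x = y` is given by the relator `x * y⁻¹`. -/
def relsPSL34 : Set (FreeGroup Gen) :=
  {s ^ 2, j ^ 2, t ^ 2, r ^ 3, (j * r) ^ 2, (t * r) ^ 2, (s * r) ^ 3, (j * s) ^ 3, (t * j) ^ 3,
    (t * s * t * j * s) ^ 3,
    ((t * s * t) * (j * r) * (t * s * t)) *
      ((r * s * r⁻¹ * j * r) * (t * s * t) * (r * s * r⁻¹ * j * r⁻¹ * s * r⁻¹))⁻¹}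

/-- The additional relators for `M₂₂`. -/
def relsU : Set (FreeGroup Gen) :=
  {u ^ 2, (u * s) ^ 2, (u * j) ^ 3,
    cj r u * (cj r j)⁻¹,
    cj s (t * u) * (s * cj s t)⁻¹,
    cj s (j * t * u) * (cj s (j * t) * cj s (t * j * t))⁻¹}

/-- The additional relators for `M₂₃`. -/
def relsV : Set (FreeGroup Gen) :=
  {v ^ 2, (v * s) ^ 2, (v * u) ^ 3, (v * j) ^ 2, (v * r) ^ 2,
    cj s (t * v) * (cj s (t * r))⁻¹,
    cj s (j * t * v) * (cj s (j * t * r))⁻¹}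

/-- The additional relators for `M₂₄`. -/
def relsW : Set (FreeGroup Gen) :=
  {w ^ 2, (w * r) ^ 2, (w * s) ^ 2, (w * j) ^ 2, (w * u) ^ 2, (w * cj s t) ^ 2,
    (w * cj s (j * t)) ^ 2, (w * v) ^ 3}

/-- All the relators for `M₂₄`. -/
def relsM24 : Set (FreeGroup Gen) := relsPSL34 ∪ relsU ∪ relsV ∪ relsW

end Mathieu

end

/-!
In any group that satisfies the relations there is a chain of subgroups
`borel ≤ para ≤ linear ≤ deg22 ≤ deg23 ≤ deg24`, where each `K` is `H ⊔ ⟨g⟩` for the preceding `H`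
and an involution `g`, one of `k = 𝔱𝔧𝔱`, `𝔧`, `𝔲`, `𝔳` and `𝔴` in turn. Each step satisfies
`K = H ∪ H g H`. For `k` and `𝔧` this is the rank-one computation in `SL₂(4)`. For `𝔲`, `𝔳` and `𝔴`,
the involution `g` normalizes the subgroup `L` before `H`, where `H = L ∪ L h L`, and it satisfies
the braid relation `g h g = h g h`.

Under a homomorphism to the Mathieu group, the subgroup `H` stabilizes an object that `g` moves: the
line of points `[x, y, 0]`, then the point `[1, 0, 0]`, then `u`, `v` and `w`. So an element of `K`
that acts trivially cannot lie in `H g H`, and the kernel descends to `borel`, whose elements are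
products of three root elements and a power of `𝔯` and are determined by their action on the plane.
-/

noncomputable section

namespace Mathieu

section Involutions

variable {G : Type*} [Group G] {g x y z : G}

theorem inv_eq_self_of_sq (hx : x ^ 2 = 1) : x⁻¹ = x :=
  inv_eq_of_mul_eq_one_left (by rwa [← sq])

theorem conj_apply_of_sq (hg : g ^ 2 = 1) (x : G) : MulAut.conj g x = g * x * g := by
  rw [MulAut.conj_apply, inv_eq_self_of_sq hg]

theorem conj_mul_apply (g h x : G) : MulAut.conj (g * h) x = MulAut.conj g (MulAut.conj h x) := by
  rw [map_mul, MulAut.mul_apply]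

theorem conj_conj_of_sq (hg : g ^ 2 = 1) (x : G) : MulAut.conj g (MulAut.conj g x) = x := by
  rw [← conj_mul_apply, ← sq, hg, map_one, MulAut.one_apply]

theorem conj_sq_eq_one (g : G) (hx : x ^ 2 = 1) : MulAut.conj g x ^ 2 = 1 := by
  rw [← map_pow, hx, map_one]

theorem conj_eq_inv (hg : g ^ 2 = 1) (h : (g * x) ^ 2 = 1) : MulAut.conj g x = x⁻¹ := by
  rw [conj_apply_of_sq hg, eq_inv_iff_mul_eq_one, mul_assoc, ← sq, h]

theorem conj_eq_self (hg : g ^ 2 = 1) (hx : x ^ 2 = 1) (h : (g * x) ^ 2 = 1) :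
    MulAut.conj g x = x := by
  rw [conj_eq_inv hg h, inv_eq_self_of_sq hx]

theorem conj_eq_self_iff_commute : MulAut.conj g x = x ↔ Commute g x := by
  rw [MulAut.conj_apply, mul_inv_eq_iff_eq_mul, commute_iff_eq]

theorem commute_of_sq (hx : x ^ 2 = 1) (hy : y ^ 2 = 1) (h : (x * y) ^ 2 = 1) : Commute x y :=
  conj_eq_self_iff_commute.1 (conj_eq_self hx hy h)

theorem braid_of_cube (hx : x ^ 2 = 1) (hy : y ^ 2 = 1) (h : (x * y) ^ 3 = 1) :
    x * y * x = y * x * y := by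
  calc x * y * x = (x * y) ^ 3 * (y⁻¹ * x⁻¹ * y⁻¹) := by
        simp only [pow_succ, pow_zero, one_mul, mul_assoc, mul_inv_cancel_left, mul_inv_cancel,
          mul_one]
    _ = y * x * y := by rw [h, one_mul, inv_eq_self_of_sq hx, inv_eq_self_of_sq hy]

theorem conj_of_long_relation (hg : g ^ 2 = 1) (hx : x ^ 2 = 1)
    (hgx : g * x * g = x * g * x) (h : z * g * z = x * g * z * x * g * x) :
    MulAut.conj x (MulAut.conj g z) = z * MulAut.conj g z := by
  rw [conj_apply_of_sq hx, conj_apply_of_sq hg]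
  calc x * (g * z * g) * x = x * g * z * (g * x * g) * g⁻¹ := by group
    _ = z * g * z * g⁻¹ := by rw [hgx, h]; group
    _ = z * (g * z * g) := by rw [inv_eq_self_of_sq hg]; group

theorem commute_conj_of_long_relation (hz : z ^ 2 = 1) (hg : g ^ 2 = 1) (hx : x ^ 2 = 1)
    (hgx : g * x * g = x * g * x) (h : z * g * z = x * g * z * x * g * x) :
    Commute z (MulAut.conj g z) := by
  refine commute_of_sq hz (conj_sq_eq_one g hz) ?_
  rw [← conj_of_long_relation hg hx hgx h]
  exact conj_sq_eq_one x (conj_sq_eq_one g hz)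

theorem commute_of_long_relation (hz : z ^ 2 = 1) (hg : g ^ 2 = 1) (hx : x ^ 2 = 1)
    (hgx : g * x * g = x * g * x) (h : z * g * z = x * g * z * x * g * x) : Commute x z := by
  have hconj := conj_of_long_relation hg hx hgx h
  have hswap : MulAut.conj g (z * MulAut.conj g z) = z * MulAut.conj g z := by
    rw [map_mul, conj_conj_of_sq hg, (commute_conj_of_long_relation hz hg hx hgx h).eq]
  have hbraid : MulAut.conj g (MulAut.conj x (MulAut.conj g z)) =
      MulAut.conj x (MulAut.conj g (MulAut.conj x z)) := by
    simp only [← conj_mul_apply, hgx, ← mul_assoc]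
  rw [hconj, hswap, ← hconj, EmbeddingLike.apply_eq_iff_eq, EmbeddingLike.apply_eq_iff_eq] at hbraid
  exact conj_eq_self_iff_commute.1 hbraid.symm

end Involutions

section BruhatCells

variable {G : Type*} [Group G] {H K L : Subgroup G} {g h x y : G}

/-- The union `H ∪ HgH`. In a group with a Tits system, if `H` is a parabolic subgroup and `g` a
further simple reflection, this is a parabolic subgroup of rank one over `H`. -/
def cells (H : Subgroup G) (g : G) : Set G := H ∪ DoubleCoset.doubleCoset g H H

theorem mem_cells_of_mem (hx : x ∈ H) : x ∈ cells H g := Or.inl hx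

theorem mul_mul_mem_cells (hx : x ∈ H) (hy : y ∈ H) : x * g * y ∈ cells H g :=
  Or.inr (DoubleCoset.mem_doubleCoset.2 ⟨x, hx, y, hy, rfl⟩)

theorem mem_cells_iff : x ∈ cells H g ↔ x ∈ H ∨ ∃ a ∈ H, ∃ b ∈ H, x = a * g * b :=
  or_congr Iff.rfl DoubleCoset.mem_doubleCoset

theorem mul_mem_cells (hx : x ∈ H) (hy : y ∈ cells H g) : x * y ∈ cells H g := by
  obtain hy | ⟨a, ha, b, hb, rfl⟩ := mem_cells_iff.1 hy
  · exact mem_cells_of_mem (mul_mem hx hy)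
  · simpa only [mul_assoc] using mul_mul_mem_cells (mul_mem hx ha) hb

theorem mem_cells_mul (hx : x ∈ cells H g) (hy : y ∈ H) : x * y ∈ cells H g := by
  obtain hx | ⟨a, ha, b, hb, rfl⟩ := mem_cells_iff.1 hx
  · exact mem_cells_of_mem (mul_mem hx hy)
  · simpa only [mul_assoc] using mul_mul_mem_cells ha (mul_mem hb hy)

theorem sup_zpowers_subset_cells (hg : g ^ 2 = 1)
    (hconj : ∀ x ∈ H, MulAut.conj g x ∈ cells H g) :
    ((H ⊔ Subgroup.zpowers g : Subgroup G) : Set G) ⊆ cells H g := by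
  have mul_g (y) (hy : y ∈ cells H g) : y * g ∈ cells H g := by
    obtain hy | ⟨a, ha, b, hb, rfl⟩ := mem_cells_iff.1 hy
    · simpa only [mul_one] using mul_mul_mem_cells hy H.one_mem
    · simpa only [conj_apply_of_sq hg, mul_assoc] using mul_mem_cells ha (hconj b hb)
  intro x hx
  rw [← Subgroup.closure_eq H, Subgroup.zpowers_eq_closure, ← Subgroup.closure_union] at hx
  induction hx using Subgroup.closure_induction_right with
  | one => exact mem_cells_of_mem H.one_mem
  | mul_right y z _ hz ih =>
    obtain hz | rfl := hz
    exacts [mem_cells_mul ih hz, mul_g y ih]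
  | mul_inv_cancel y z _ hz ih =>
    obtain hz | rfl := hz
    · exact mem_cells_mul ih (inv_mem hz)
    · rw [inv_eq_self_of_sq hg]
      exact mul_g y ih

theorem conj_mem_cells_of_braid (hKH : K ≤ H) (hh : h ∈ H) (hg : g ^ 2 = 1)
    (hH : (H : Set G) ⊆ cells K h) (hK : ∀ x ∈ K, MulAut.conj g x ∈ K)
    (hbraid : g * h * g = h * g * h) (hx : x ∈ H) : MulAut.conj g x ∈ cells H g := by
  obtain hx | ⟨a, ha, b, hb, rfl⟩ := mem_cells_iff.1 (hH hx)
  · exact mem_cells_of_mem (hKH (hK x hx))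
  · rw [map_mul, map_mul, conj_apply_of_sq hg h, hbraid]
    simpa only [mul_assoc] using mul_mul_mem_cells (g := g)
      (mul_mem (hKH (hK a ha)) hh) (mul_mem hh (hKH (hK b hb)))

theorem map_mem_cells {G' : Type*} [Group G'] {H : Subgroup G'} (f : G →* G')
    (hx : x ∈ cells (H.comap f) g) : f x ∈ cells H (f g) := by
  obtain hx | ⟨a, ha, b, hb, rfl⟩ := mem_cells_iff.1 hx
  · exact mem_cells_of_mem hx
  · rw [map_mul, map_mul]
    exact mul_mul_mem_cells ha hb

theorem mem_of_mem_cells (hHL : H ≤ L) (hg : g ∉ L) (hxL : x ∈ L) (hx : x ∈ cells H g) :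
    x ∈ H := by
  obtain hx | ⟨a, ha, b, hb, rfl⟩ := mem_cells_iff.1 hx
  · exact hx
  · exact absurd ((L.mul_mem_cancel_left (hHL ha)).1 ((L.mul_mem_cancel_right (hHL hb)).1 hxL)) hg

end BruhatCells

/-- An explicit model `{0, 1, ζ, ζ²}` of the field `GF(4)`, in which identities can be checked by
evaluation. -/
inductive GF4 : Type
  | zero
  | one
  | ζ
  | ζsq
  deriving DecidableEq

namespace GF4

instance : Fintype GF4 where
  elems := {zero, one, ζ, ζsq}
  complete c := by cases c <;> decide

instance : Zero GF4 := ⟨zero⟩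

instance : One GF4 := ⟨one⟩

instance : Neg GF4 := ⟨id⟩

instance : Add GF4 where
  add
    | zero, d => d
    | c, zero => c
    | one, one | ζ, ζ | ζsq, ζsq => zero
    | one, ζ | ζ, one => ζsq
    | one, ζsq | ζsq, one => ζ
    | ζ, ζsq | ζsq, ζ => one

instance : Mul GF4 where
  mul
    | zero, _ | _, zero => zero
    | one, d => d
    | c, one => c
    | ζ, ζ => ζsq
    | ζ, ζsq | ζsq, ζ => one
    | ζsq, ζsq => ζ

instance : Inv GF4 where
  inv
    | zero => zero
    | one => one
    | ζ => ζsq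
    | ζsq => ζ

instance : Field GF4 where
  add_assoc := by decide
  zero_add := by decide
  add_zero := by decide
  add_comm := by decide
  neg_add_cancel := by decide
  mul_assoc := by decide
  one_mul := by decide
  mul_one := by decide
  zero_mul := by decide
  mul_zero := by decide
  mul_comm := by decide
  left_distrib := by decide
  right_distrib := by decide
  exists_pair_ne := ⟨0, 1, by decide⟩
  mul_inv_cancel := by decide
  inv_zero := rfl
  nsmul := nsmulRec
  zsmul := zsmulRec
  nnqsmul := _
  qsmul := _

theorem induction_on {d : GF4} (hd : d ≠ 0) {Q : GF4 → Prop} (c : GF4) (base : Q d) (zero : Q 0)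
    (mul_ζ : ∀ a, Q a → Q (ζ * a)) : Q c := by
  have eq_pow_mul : ∀ c d : GF4, d ≠ 0 → c = 0 ∨ c = d ∨ c = ζ * d ∨ c = ζ * (ζ * d) := by decide
  rcases eq_pow_mul c d hd with rfl | rfl | rfl | rfl
  exacts [zero, base, mul_ζ _ base, mul_ζ _ (mul_ζ _ base)]

theorem add_self (c : GF4) : c + c = 0 := by decide +revert

end GF4

/-- Elements of a group that satisfy the relations among `𝔰, 𝔧, 𝔱, 𝔯` in the presentation. -/
structure LinearTuple (G : Type*) [Group G] where
  s : G
  j : G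
  t : G
  r : G
  s_sq : s ^ 2 = 1
  j_sq : j ^ 2 = 1
  t_sq : t ^ 2 = 1
  r_cube : r ^ 3 = 1
  jr_sq : (j * r) ^ 2 = 1
  tr_sq : (t * r) ^ 2 = 1
  sr_cube : (s * r) ^ 3 = 1
  js_cube : (j * s) ^ 3 = 1
  tj_cube : (t * j) ^ 3 = 1
  tstjs_cube : (t * s * t * j * s) ^ 3 = 1
  long : (t * s * t) * (j * r) * (t * s * t) =
    (r * s * r⁻¹ * j * r) * (t * s * t) * (r * s * r⁻¹ * j * r⁻¹ * s * r⁻¹)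

namespace LinearTuple

variable {G : Type*} [Group G] (P : LinearTuple G)

/-- Conjugation by `𝔧`. -/
abbrev cJ : MulAut G := MulAut.conj P.j

/-- Conjugation by `𝔱`. -/
abbrev cT : MulAut G := MulAut.conj P.t

/-- Conjugation by `𝔯`. -/
abbrev cR : MulAut G := MulAut.conj P.r

theorem cJ_cJ (x : G) : P.cJ (P.cJ x) = x := conj_conj_of_sq P.j_sq x

theorem cT_cT (x : G) : P.cT (P.cT x) = x := conj_conj_of_sq P.t_sq x

theorem cR_cR_cR (x : G) : P.cR (P.cR (P.cR x)) = x := by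
  rw [← conj_mul_apply, ← conj_mul_apply, ← pow_three', P.r_cube, map_one, MulAut.one_apply]

theorem cJ_r : P.cJ P.r = P.r⁻¹ := conj_eq_inv P.j_sq P.jr_sq

theorem cT_r : P.cT P.r = P.r⁻¹ := conj_eq_inv P.t_sq P.tr_sq

theorem r_inv : P.r⁻¹ = P.r * P.r :=
  inv_eq_of_mul_eq_one_left (by rw [mul_assoc, ← pow_three, P.r_cube])

theorem cR_cJ (x : G) : P.cR (P.cJ x) = P.cJ (P.cR (P.cR x)) := by
  have h : P.r * P.j = P.j * (P.r * P.r) := by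
    rw [← r_inv, ← cJ_r, conj_apply_of_sq P.j_sq, ← mul_assoc, ← mul_assoc, ← sq, P.j_sq, one_mul]
  simp only [← conj_mul_apply, h]

theorem cR_cT (x : G) : P.cR (P.cT x) = P.cT (P.cR (P.cR x)) := by
  have h : P.r * P.t = P.t * (P.r * P.r) := by
    rw [← r_inv, ← cT_r, conj_apply_of_sq P.t_sq, ← mul_assoc, ← mul_assoc, ← sq, P.t_sq, one_mul]
  simp only [← conj_mul_apply, h]

theorem cR_cR_cJ (x : G) : P.cR (P.cR (P.cJ x)) = P.cJ (P.cR x) := by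
  rw [cR_cJ, cR_cJ, cR_cR_cR]

theorem jtj : P.j * P.t * P.j = P.t * P.j * P.t :=
  (braid_of_cube P.t_sq P.j_sq P.tj_cube).symm

theorem jsj : P.j * P.s * P.j = P.s * P.j * P.s := braid_of_cube P.j_sq P.s_sq P.js_cube

theorem cJ_cT_cJ (x : G) : P.cJ (P.cT (P.cJ x)) = P.cT (P.cJ (P.cT x)) := by
  simp only [← conj_mul_apply, ← mul_assoc, P.jtj]

theorem cR_conj (x y : G) : P.cR (MulAut.conj x y) = MulAut.conj (P.cR x) (P.cR y) := by
  simp only [MulAut.conj_apply x, MulAut.conj_apply (P.cR x), map_mul, map_inv]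

/-- The root element of the upper left `SL₂`, i.e. the element `x₀₁(c) = 1 + c E₀₁` when `G` is
`PSL₃(4)`. -/
def baseRoot : GF4 → G
  | GF4.zero => 1
  | GF4.one => P.s
  | GF4.ζ => P.cR P.s
  | GF4.ζsq => P.cR (P.cR P.s)

/-- The root element `xᵢₖ(c)`, equal to the transvection `1 + c Eᵢₖ` when `G` is `PSL₃(4)`. The
diagonal values are junk. -/
def root (i k : Fin 3) (c : GF4) : G :=
  match i, k with
  | 0, 1 => P.baseRoot c
  | 1, 0 => P.cJ (P.baseRoot c)
  | 2, 1 => P.cT (P.baseRoot c)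
  | 1, 2 => P.cT (P.cJ (P.baseRoot c))
  | 2, 0 => P.cJ (P.cT (P.baseRoot c))
  | 0, 2 => P.cT (P.cJ (P.cT (P.baseRoot c)))
  | 0, 0 | 1, 1 | 2, 2 => 1

theorem root_zero_one_one : P.root 0 1 1 = P.s := rfl

theorem cJ_root (i k : Fin 3) (c : GF4) :
    P.cJ (P.root i k c) = P.root (![1, 0, 2] i) (![1, 0, 2] k) c := by
  fin_cases i <;> fin_cases k
  exacts [map_one _, rfl, (P.cJ_cT_cJ _).trans (congrArg _ (congrArg _ (P.cT_cT _))),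
    P.cJ_cJ _, map_one _, P.cJ_cT_cJ _,
    P.cJ_cJ _, rfl, map_one _]

theorem cT_root (i k : Fin 3) (c : GF4) :
    P.cT (P.root i k c) = P.root (![2, 1, 0] i) (![2, 1, 0] k) c := by
  fin_cases i <;> fin_cases k
  exacts [map_one _, rfl, P.cT_cT _, rfl, map_one _, P.cT_cT _, rfl, P.cT_cT _, map_one _]

theorem cR_baseRoot (c : GF4) : P.cR (P.baseRoot c) = P.baseRoot (GF4.ζ * c) := by
  cases c
  exacts [map_one _, rfl, rfl, P.cR_cR_cR _]

/-- The entry at `(i, k)` of the matrix is `dᵢ / dₖ` for `d = (ζ, 1, ζ⁻¹)`, the diagonal of the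
matrix that induces `𝔯`. -/
theorem cR_root (i k : Fin 3) (c : GF4) :
    P.cR (P.root i k c) = P.root i k
      (![![1, GF4.ζ, GF4.ζ ^ 2], ![GF4.ζ ^ 2, 1, GF4.ζ], ![GF4.ζ, GF4.ζ ^ 2, 1]] i k * c) := by
  fin_cases i <;> fin_cases k
  all_goals
    simp only [root, map_one, cR_cJ, cR_cT, cR_baseRoot, Fin.zero_eta, Fin.mk_one, Fin.reduceFinMk,
      Matrix.cons_val]
  all_goals cases c <;> rfl

theorem baseRoot_sq (c : GF4) : P.baseRoot c ^ 2 = 1 := by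
  cases c
  exacts [one_pow 2, P.s_sq, conj_sq_eq_one _ P.s_sq, conj_sq_eq_one _ (conj_sq_eq_one _ P.s_sq)]

theorem baseRoot_mul_baseRoot_ζ_mul (c : GF4) :
    P.baseRoot c * P.baseRoot (GF4.ζ * c) = P.baseRoot (GF4.ζ ^ 2 * c) := by
  induction c using GF4.induction_on one_ne_zero with
  | zero => exact one_mul 1
  | base =>
    have h : P.s * P.cR P.s * P.cR (P.cR P.s) = (P.s * P.r) ^ 3 * (P.r ^ 3)⁻¹ := by
      simp only [MulAut.conj_apply, pow_succ, pow_zero, one_mul, mul_inv_rev, mul_assoc,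
        inv_mul_cancel_left, mul_inv_cancel_left]
    rw [P.sr_cube, P.r_cube, inv_one, one_mul] at h
    exact mul_eq_one_iff_eq_inv.1 h |>.trans (inv_eq_self_of_sq (P.baseRoot_sq GF4.ζsq))
  | mul_ζ c ih =>
    simpa only [map_mul, cR_baseRoot, mul_left_comm GF4.ζ (GF4.ζ ^ 2)] using congrArg P.cR ih

theorem baseRoot_add (c d : GF4) : P.baseRoot (c + d) = P.baseRoot c * P.baseRoot d := by
  have base_inv (c) : (P.baseRoot c)⁻¹ = P.baseRoot c := inv_eq_self_of_sq (P.baseRoot_sq c)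
  have add_ζ_mul : ∀ c : GF4, c + GF4.ζ * c = GF4.ζ ^ 2 * c := by decide
  have cases : ∀ c d : GF4, c = 0 ∨ d = 0 ∨ c = d ∨ d = GF4.ζ * c ∨ c = GF4.ζ * d := by decide
  rcases cases c d with rfl | rfl | rfl | rfl | rfl
  · rw [zero_add]
    exact (one_mul _).symm
  · rw [add_zero]
    exact (mul_one _).symm
  · rw [GF4.add_self, ← sq, baseRoot_sq]
    rfl
  · rw [add_ζ_mul, baseRoot_mul_baseRoot_ζ_mul]
  · rw [add_comm, add_ζ_mul, ← base_inv, ← baseRoot_mul_baseRoot_ζ_mul, mul_inv_rev, base_inv,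
      base_inv]

theorem root_zero (i k : Fin 3) : P.root i k 0 = 1 := by
  fin_cases i <;> fin_cases k <;>
    simp only [root, show P.baseRoot 0 = 1 from rfl, map_one]

theorem root_add (i k : Fin 3) (c d : GF4) :
    P.root i k (c + d) = P.root i k c * P.root i k d := by
  fin_cases i <;> fin_cases k <;> simp only [root, baseRoot_add, map_mul, mul_one]

theorem root_sq (i k : Fin 3) (c : GF4) : P.root i k c ^ 2 = 1 := by
  rw [sq, ← root_add, GF4.add_self, root_zero]

theorem root_inv (i k : Fin 3) (c : GF4) : (P.root i k c)⁻¹ = P.root i k c :=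
  inv_eq_self_of_sq (P.root_sq i k c)

/-! ### Commutator relations -/

theorem cR_j : P.cR P.j = P.j * P.r := by
  have h : P.r * P.j = P.j * P.r⁻¹ := by
    rw [← cJ_r, conj_apply_of_sq P.j_sq, ← mul_assoc, ← mul_assoc, ← sq, P.j_sq, one_mul]
  rw [MulAut.conj_apply, h, mul_assoc, ← mul_inv_rev, ← r_inv, inv_inv]

theorem conj_jr_root_two_one :
    MulAut.conj (P.j * P.r) (P.root 2 1 1) = P.root 2 0 (GF4.ζ ^ 2) := by
  rw [conj_mul_apply, cR_root, cJ_root]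
  rfl

theorem jr_braid : P.j * P.r * P.root 0 1 GF4.ζ * (P.j * P.r) =
    P.root 0 1 GF4.ζ * (P.j * P.r) * P.root 0 1 GF4.ζ := by
  rw [← cR_j]
  have h := congrArg P.cR P.jsj
  simp only [map_mul] at h
  exact h

theorem long_root : P.root 2 1 1 * (P.j * P.r) * P.root 2 1 1 =
    P.root 0 1 GF4.ζ * (P.j * P.r) * P.root 2 1 1 * P.root 0 1 GF4.ζ * (P.j * P.r) *
      P.root 0 1 GF4.ζ := by
  have h₂₁ : P.root 2 1 1 = P.t * P.s * P.t := conj_apply_of_sq P.t_sq _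
  have h₀₁ : P.root 0 1 GF4.ζ = P.r * P.s * P.r⁻¹ := rfl
  rw [h₂₁, P.long, h₀₁]
  simp only [r_inv, mul_assoc]

theorem conj_root_zero_one_root_two_zero_ζ_mul (c : GF4) :
    MulAut.conj (P.root 0 1 c) (P.root 2 0 (GF4.ζ * c)) =
      P.root 2 1 (GF4.ζ * c ^ 2) * P.root 2 0 (GF4.ζ * c) := by
  induction c using GF4.induction_on (d := GF4.ζ) (by decide) with
  | zero => simp only [zero_pow two_ne_zero, mul_zero, root_zero, map_one, mul_one]
  | base =>
    have h := conj_of_long_relation P.jr_sq (P.root_sq 0 1 GF4.ζ) P.jr_braid P.long_root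
    rwa [conj_jr_root_two_one] at h
  | mul_ζ c ih =>
    have hc : GF4.ζ ^ 2 * (GF4.ζ * c ^ 2) = GF4.ζ * (GF4.ζ * c) ^ 2 := by ring
    simpa only [cR_conj, map_mul, cR_root, Matrix.cons_val, hc] using congrArg P.cR ih

theorem commute_root_two_one_root_two_zero_ζ_mul (c : GF4) :
    Commute (P.root 2 1 (GF4.ζ * c ^ 2)) (P.root 2 0 (GF4.ζ * c)) := by
  refine commute_of_sq (P.root_sq _ _ _) (P.root_sq _ _ _) ?_
  rw [← conj_root_zero_one_root_two_zero_ζ_mul]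
  exact conj_sq_eq_one _ (P.root_sq _ _ _)

theorem commute_root_zero_one_ζ_mul_root_two_one (c : GF4) :
    Commute (P.root 0 1 (GF4.ζ * c)) (P.root 2 1 (c ^ 2)) := by
  induction c using GF4.induction_on one_ne_zero with
  | zero => simp only [mul_zero, root_zero, Commute.one_left]
  | base =>
    simpa only [mul_one, one_pow] using commute_of_long_relation (P.root_sq 2 1 1) P.jr_sq
      (P.root_sq 0 1 GF4.ζ) P.jr_braid P.long_root
  | mul_ζ c ih => simpa only [cR_root, Matrix.cons_val, ← mul_pow] using ih.map P.cR

theorem conj_s_root_two_zero_one :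
    MulAut.conj P.s (P.root 2 0 1) = P.root 2 1 1 * P.cJ (MulAut.conj P.s (P.root 2 1 1)) := by
  have hz : P.t * P.s * P.t = P.root 2 1 1 := (conj_apply_of_sq P.t_sq _).symm
  have hcube := P.tstjs_cube
  rw [hz] at hcube
  have h20 : P.root 2 0 1 = P.j * P.root 2 1 1 * P.j := conj_apply_of_sq P.j_sq _
  have hzz : (P.root 2 1 1)⁻¹ = P.root 2 1 1 := P.root_inv 2 1 1
  set z := P.root 2 1 1
  have hjj : P.j * P.j = 1 := by rw [← sq, P.j_sq]
  symm
  rw [h20, conj_apply_of_sq P.j_sq, conj_apply_of_sq P.s_sq, conj_apply_of_sq P.s_sq,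
    ← mul_inv_eq_one]
  calc z * (P.j * (P.s * z * P.s) * P.j) * (P.s * (P.j * z * P.j) * P.s)⁻¹
      = z * P.j * P.s * z * (P.s * P.j * P.s⁻¹) * P.j⁻¹ * z⁻¹ * P.j⁻¹ * P.s⁻¹ := by group
    _ = z * P.j * P.s * z * (P.j * P.s * (P.j * P.j)) * z * P.j * P.s := by
      rw [inv_eq_self_of_sq P.s_sq, ← jsj, inv_eq_self_of_sq P.j_sq, hzz]
      group
    _ = (z * P.j * P.s) ^ 3 := by
      rw [hjj]
      simp only [pow_succ, pow_zero, one_mul, mul_one, mul_assoc]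
    _ = 1 := hcube

theorem commute_root_two_one_cJ_conj_s :
    Commute (P.root 2 1 1) (P.cJ (MulAut.conj P.s (P.root 2 1 1))) := by
  refine commute_of_sq (P.root_sq 2 1 1)
    (conj_sq_eq_one _ (conj_sq_eq_one _ (P.root_sq 2 1 1))) ?_
  rw [← conj_s_root_two_zero_one]
  exact conj_sq_eq_one _ (P.root_sq 2 0 1)

theorem conj_s_root_two_one_mul_root_two_one_ζ :
    MulAut.conj P.s (P.root 2 1 1) * P.root 2 1 GF4.ζ =
      P.cR (MulAut.conj P.s (P.root 2 1 1)) := by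
  have fixed {c d : GF4} (e : GF4) (hc : GF4.ζ * e = c) (hd : e ^ 2 = d) :
      MulAut.conj (P.root 0 1 c) (P.root 2 1 d) = P.root 2 1 d := by
    rw [conj_eq_self_iff_commute, ← hc, ← hd]
    exact P.commute_root_zero_one_ζ_mul_root_two_one e
  have hζ : (1 : GF4) + GF4.ζ = GF4.ζ ^ 2 := rfl
  have hζsq : (1 : GF4) + GF4.ζ ^ 2 = GF4.ζ := rfl
  calc MulAut.conj (P.root 0 1 1) (P.root 2 1 1) * P.root 2 1 GF4.ζ
      = MulAut.conj (P.root 0 1 1) (P.root 2 1 (GF4.ζ ^ 2)) := by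
        rw [← hζ, root_add, map_mul, fixed (c := 1) (d := GF4.ζ) (GF4.ζ ^ 2) rfl rfl]
    _ = MulAut.conj (P.root 0 1 1) (MulAut.conj (P.root 0 1 (GF4.ζ ^ 2))
          (P.root 2 1 (GF4.ζ ^ 2))) := by rw [fixed (c := GF4.ζ ^ 2) (d := GF4.ζ ^ 2) GF4.ζ rfl rfl]
    _ = MulAut.conj (P.root 0 1 GF4.ζ) (P.root 2 1 (GF4.ζ ^ 2)) := by
        rw [← conj_mul_apply, ← root_add, hζsq]
    _ = P.cR (MulAut.conj (P.root 0 1 1) (P.root 2 1 1)) := by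
        rw [cR_conj, cR_root, cR_root]
        rfl

theorem conj_root_zero_one_ζsq_root_two_zero_ζsq :
    MulAut.conj (P.root 0 1 (GF4.ζ ^ 2)) (P.root 2 0 (GF4.ζ ^ 2)) =
      MulAut.conj P.s (P.root 2 1 1) * P.root 2 1 1 *
        (P.cJ (P.cR (MulAut.conj P.s (P.root 2 1 1))) * P.root 2 1 GF4.ζ) := by
  have long_one := P.conj_root_zero_one_root_two_zero_ζ_mul 1
  have long_ζ := P.conj_root_zero_one_root_two_zero_ζ_mul GF4.ζ
  have comm := P.commute_root_two_one_root_two_zero_ζ_mul 1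
  simp only [mul_one, one_pow, root_zero_one_one] at long_one comm
  have h₀₁ : P.root 0 1 (GF4.ζ ^ 2) = P.s * P.root 0 1 GF4.ζ := P.root_add 0 1 1 GF4.ζ
  have h₂₀ : P.root 2 0 (GF4.ζ ^ 2) = P.root 2 0 1 * P.root 2 0 GF4.ζ := P.root_add 2 0 1 GF4.ζ
  have cJ₂₁ : P.cJ (P.root 2 1 GF4.ζ) = P.root 2 0 GF4.ζ := P.cJ_root 2 1 GF4.ζ
  set V := MulAut.conj P.s (P.root 2 1 1) with hV
  calc MulAut.conj (P.root 0 1 (GF4.ζ ^ 2)) (P.root 2 0 (GF4.ζ ^ 2))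
      = MulAut.conj P.s (P.root 2 1 1 * P.root 2 0 (GF4.ζ ^ 2)) := by
        rw [h₀₁, conj_mul_apply]
        exact congrArg _ long_ζ
    _ = V * (P.root 2 1 1 * P.cJ V) * (P.root 2 1 GF4.ζ * P.root 2 0 GF4.ζ) := by
        rw [h₂₀, map_mul, map_mul, conj_s_root_two_zero_one, long_one, ← hV]
        simp only [mul_assoc]
    _ = V * P.root 2 1 1 * (P.cJ (V * P.root 2 1 GF4.ζ) * P.root 2 1 GF4.ζ) := by
        rw [comm.eq, map_mul, cJ₂₁]
        simp only [mul_assoc]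
    _ = _ := by rw [hV, conj_s_root_two_one_mul_root_two_one_ζ]

theorem conj_s_root_two_one : MulAut.conj P.s (P.root 2 1 1) = P.root 2 1 1 := by
  have expand := P.conj_root_zero_one_ζsq_root_two_zero_ζsq
  have rotate : MulAut.conj (P.root 0 1 (GF4.ζ ^ 2)) (P.root 2 0 (GF4.ζ ^ 2)) =
      P.root 2 1 GF4.ζ * P.cJ (P.cR (MulAut.conj P.s (P.root 2 1 1))) := by
    have h := congrArg (fun x => P.cR (P.cR x)) P.conj_s_root_two_zero_one
    simp only [map_mul, cR_cR_cJ] at h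
    rwa [cR_conj P P.s, cR_conj P (P.cR P.s), cR_root, cR_root, cR_root, cR_root] at h
  have comm : Commute (P.root 2 1 GF4.ζ) (P.cJ (P.cR (MulAut.conj P.s (P.root 2 1 1)))) := by
    have h := (P.commute_root_two_one_cJ_conj_s.map P.cR).map P.cR
    rwa [cR_cR_cJ, cR_root, cR_root] at h
  rw [rotate, comm.eq] at expand
  exact (mul_eq_one_iff_eq_inv.1 (mul_eq_right.1 expand.symm)).trans (P.root_inv 2 1 1)

theorem conj_root_zero_one_root_two_zero_self (c : GF4) :
    MulAut.conj (P.root 0 1 c) (P.root 2 0 c) = P.root 2 1 (c ^ 2) * P.root 2 0 c := by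
  induction c using GF4.induction_on one_ne_zero with
  | zero => simp only [zero_pow two_ne_zero, root_zero, map_one, mul_one]
  | base =>
    rw [root_zero_one_one, conj_s_root_two_zero_one, conj_s_root_two_one, cJ_root, one_pow]
    rfl
  | mul_ζ c ih =>
    simpa only [cR_conj, map_mul, cR_root, Matrix.cons_val, mul_pow] using congrArg P.cR ih

theorem commute_root_two_one_root_two_zero_self (c : GF4) :
    Commute (P.root 2 1 (c ^ 2)) (P.root 2 0 c) := by
  refine commute_of_sq (P.root_sq _ _ _) (P.root_sq _ _ _) ?_
  rw [← conj_root_zero_one_root_two_zero_self]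
  exact conj_sq_eq_one _ (P.root_sq _ _ _)

theorem commute_root_two_one_sq_root_two_zero_ζ_mul (c : GF4) :
    Commute (P.root 2 1 (c ^ 2)) (P.root 2 0 (GF4.ζ * c)) := by
  have hc : GF4.ζ * c ^ 2 + (GF4.ζ * c) ^ 2 = c ^ 2 := by
    revert c
    decide
  rw [← hc, root_add]
  exact (P.commute_root_two_one_root_two_zero_ζ_mul c).mul_left
    (P.commute_root_two_one_root_two_zero_self (GF4.ζ * c))

theorem conj_root_zero_one_root_two_zero (c d : GF4) :
    MulAut.conj (P.root 0 1 c) (P.root 2 0 d) = P.root 2 1 (c * d) * P.root 2 0 d := by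
  have cases : ∀ c d : GF4, c = 0 ∨ d = 0 ∨ d = c ∨ d = GF4.ζ * c ∨ d = GF4.ζ * c + c := by decide
  rcases cases c d with rfl | rfl | rfl | rfl | rfl
  · simp only [root_zero, zero_mul, one_mul, map_one, MulAut.one_apply]
  · simp only [root_zero, mul_zero, mul_one, map_one]
  · rw [conj_root_zero_one_root_two_zero_self, sq]
  · rw [conj_root_zero_one_root_two_zero_ζ_mul, sq, mul_left_comm]
  · have comm := (P.commute_root_two_one_sq_root_two_zero_ζ_mul c).eq
    rw [root_add, map_mul, conj_root_zero_one_root_two_zero_ζ_mul,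
      conj_root_zero_one_root_two_zero_self, mul_add, mul_left_comm, ← sq, root_add]
    simp only [mul_assoc]
    rw [← mul_assoc (P.root 2 0 _), ← comm, mul_assoc]

theorem commute_root_two_one_root_two_zero (c d : GF4) :
    Commute (P.root 2 1 c) (P.root 2 0 d) := by
  rcases eq_or_ne d 0 with rfl | hd
  · simp only [root_zero, Commute.one_right]
  · rw [← div_mul_cancel₀ c hd]
    refine commute_of_sq (P.root_sq _ _ _) (P.root_sq _ _ _) ?_
    rw [← conj_root_zero_one_root_two_zero]
    exact conj_sq_eq_one _ (P.root_sq _ _ _)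

theorem commute_root_zero_one_root_zero_two (c d : GF4) :
    Commute (P.root 0 1 c) (P.root 0 2 d) := by
  simpa only [cT_root, Matrix.cons_val] using
    (P.commute_root_two_one_root_two_zero c d).map P.cT

theorem conj_root_one_two_root_zero_one (c d : GF4) :
    MulAut.conj (P.root 1 2 c) (P.root 0 1 d) = P.root 0 2 (c * d) * P.root 0 1 d := by
  have cT_cJ_conj (x y : G) : P.cT (P.cJ (MulAut.conj x y)) =
      MulAut.conj (P.cT (P.cJ x)) (P.cT (P.cJ y)) := by
    simp only [MulAut.conj_apply x, MulAut.conj_apply (P.cT (P.cJ x)), map_mul, map_inv]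
  have h := congrArg (fun x => P.cT (P.cJ x)) (P.conj_root_zero_one_root_two_zero c d)
  simpa only [cT_cJ_conj, map_mul, cJ_root, cT_root, Matrix.cons_val] using h

end LinearTuple

/-! ### Borel and parabolic subgroups -/

namespace LinearTuple

variable {G : Type*} [Group G] (P : LinearTuple G) {M : Subgroup G} {x : G}

theorem cR_mem (hr : P.r ∈ M) (hx : x ∈ M) : P.cR x ∈ M :=
  mul_mem (mul_mem hr hx) (inv_mem hr)

theorem root_ζ_mul_mem {i k : Fin 3} {c : GF4} (hr : P.r ∈ M) (h : P.root i k c ∈ M) :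
    P.root i k (GF4.ζ * c) ∈ M := by
  have once (hik : P.cR (P.root i k c) = P.root i k (GF4.ζ * c)) : P.root i k (GF4.ζ * c) ∈ M :=
    hik ▸ P.cR_mem hr h
  have twice (hik : P.cR (P.cR (P.root i k c)) = P.root i k (GF4.ζ * c)) :
      P.root i k (GF4.ζ * c) ∈ M := hik ▸ P.cR_mem hr (P.cR_mem hr h)
  have hc : GF4.ζ ^ 2 * (GF4.ζ ^ 2 * c) = GF4.ζ * c := by
    clear h once twice
    revert c
    decide
  simp only [cR_root] at once twice
  fin_cases i <;> fin_cases k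
  exacts [h, once rfl, twice (congrArg _ hc), twice (congrArg _ hc), h, once rfl, once rfl,
    twice (congrArg _ hc), h]

theorem root_mem {i k : Fin 3} (hr : P.r ∈ M) (h : P.root i k 1 ∈ M) (c : GF4) :
    P.root i k c ∈ M := by
  induction c using GF4.induction_on one_ne_zero with
  | zero => exact P.root_zero i k ▸ M.one_mem
  | base => exact h
  | mul_ζ c ih => exact P.root_ζ_mul_mem hr ih

/-- The group generated by the upper triangular elements. It is the image in `PSL₃(4)` of the group
of upper triangular matrices when `G` is `PSL₃(4)`. -/
def borel : Subgroup G := Subgroup.closure {P.s, P.r, P.root 1 2 1}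

theorem borel_le (hs : P.s ∈ M) (hr : P.r ∈ M) (hx : P.root 1 2 1 ∈ M) : P.borel ≤ M := by
  rw [borel, Subgroup.closure_le]
  rintro x (rfl | rfl | rfl) <;> assumption

theorem r_mem_borel : P.r ∈ P.borel := Subgroup.subset_closure (by simp)

theorem root_zero_one_mem_borel (c : GF4) : P.root 0 1 c ∈ P.borel :=
  P.root_mem P.r_mem_borel (Subgroup.subset_closure (Or.inl rfl)) c

theorem root_one_two_mem_borel (c : GF4) : P.root 1 2 c ∈ P.borel :=
  P.root_mem P.r_mem_borel (Subgroup.subset_closure (by simp)) c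

theorem root_zero_two_mem_borel (c : GF4) : P.root 0 2 c ∈ P.borel := by
  have h := P.conj_root_one_two_root_zero_one 1 c
  rw [one_mul, MulAut.conj_apply, ← mul_inv_eq_iff_eq_mul] at h
  rw [← h]
  have h₁₂ := P.root_one_two_mem_borel 1
  have h₀₁ := P.root_zero_one_mem_borel c
  exact mul_mem (mul_mem (mul_mem h₁₂ h₀₁) (inv_mem h₁₂)) (inv_mem h₀₁)

theorem s_mul_normal_form (f d c : GF4) (n : ℕ) :
    P.s * (P.root 1 2 f * P.root 0 2 d * P.root 0 1 c * P.r ^ n) =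
      P.root 1 2 f * P.root 0 2 (f + d) * P.root 0 1 (1 + c) * P.r ^ n := by
  have h := P.conj_root_one_two_root_zero_one f 1
  have comm := P.commute_root_zero_one_root_zero_two 1 d
  rw [conj_apply_of_sq (P.root_sq 1 2 f), root_zero_one_one, mul_one] at h
  calc P.s * (P.root 1 2 f * P.root 0 2 d * P.root 0 1 c * P.r ^ n)
      = P.root 1 2 f * (P.root 1 2 f * P.s * P.root 1 2 f) * P.root 0 2 d * P.root 0 1 c *
          P.r ^ n := by
        simp only [← mul_assoc, ← sq, root_sq, one_mul]
    _ = P.root 1 2 f * P.root 0 2 f * (P.root 0 1 1 * P.root 0 2 d) * P.root 0 1 c * P.r ^ n := by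
        rw [h]
        simp only [root_zero_one_one, mul_assoc]
    _ = _ := by
        rw [comm.eq, root_add, root_add]
        simp only [mul_assoc]

theorem r_mul_normal_form (f d c : GF4) (n : ℕ) :
    P.r * (P.root 1 2 f * P.root 0 2 d * P.root 0 1 c * P.r ^ n) =
      P.root 1 2 (GF4.ζ * f) * P.root 0 2 (GF4.ζ ^ 2 * d) * P.root 0 1 (GF4.ζ * c) *
        P.r ^ (n + 1) := by
  have h : P.cR (P.root 1 2 f * P.root 0 2 d * P.root 0 1 c) =
      P.root 1 2 (GF4.ζ * f) * P.root 0 2 (GF4.ζ ^ 2 * d) * P.root 0 1 (GF4.ζ * c) := by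
    simp only [map_mul, cR_root, Matrix.cons_val]
  rw [← h, MulAut.conj_apply, pow_succ']
  simp only [mul_assoc, inv_mul_cancel_left]

theorem exists_normal_form (hx : x ∈ P.borel) :
    ∃ f d c, ∃ n : ℕ, x = P.root 1 2 f * P.root 0 2 d * P.root 0 1 c * P.r ^ n := by
  induction hx using Subgroup.closure_induction_left with
  | one => exact ⟨0, 0, 0, 0, by simp only [root_zero, pow_zero, mul_one]⟩
  | mul_left g hg y _ ih =>
    obtain ⟨f, d, c, n, rfl⟩ := ih
    rcases hg with rfl | rfl | rfl
    · exact ⟨_, _, _, _, P.s_mul_normal_form f d c n⟩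
    · exact ⟨_, _, _, _, P.r_mul_normal_form f d c n⟩
    · exact ⟨1 + f, d, c, n, by simp only [root_add, mul_assoc]⟩
  | inv_mul_cancel g hg y _ ih =>
    obtain ⟨f, d, c, n, rfl⟩ := ih
    rcases hg with rfl | rfl | rfl
    · rw [inv_eq_self_of_sq P.s_sq, s_mul_normal_form]
      exact ⟨_, _, _, _, rfl⟩
    · rw [r_inv, mul_assoc, r_mul_normal_form, r_mul_normal_form]
      exact ⟨_, _, _, _, rfl⟩
    · exact ⟨1 + f, d, c, n, by simp only [root_inv, root_add, mul_assoc]⟩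

theorem exists_root_mul_pow_r (i k : Fin 3) (c : GF4) (n : ℕ) :
    ∃ d, P.root i k c * P.r ^ n = P.r ^ n * P.root i k d := by
  have root_mul_r (c) : ∃ d, P.root i k c * P.r = P.r * P.root i k d := by
    have h : P.cR (P.cR (P.root i k c)) = P.r⁻¹ * P.root i k c * P.r := by
      rw [← conj_mul_apply, ← r_inv, MulAut.conj_apply, inv_inv]
    rw [cR_root, cR_root] at h
    exact ⟨_, by rw [h, ← mul_assoc, mul_inv_cancel_left]⟩
  induction n generalizing c with
  | zero => exact ⟨c, by rw [pow_zero, one_mul, mul_one]⟩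
  | succ n ih =>
    obtain ⟨d, hd⟩ := root_mul_r c
    obtain ⟨e, he⟩ := ih d
    exact ⟨e, by rw [pow_succ', ← mul_assoc, hd, mul_assoc, he, mul_assoc]⟩

/-- The second simple reflection. In `PSL₃(4)` it interchanges the last two coordinates. -/
def k : G := P.t * P.j * P.t

theorem cT_j : P.cT P.j = P.k := conj_apply_of_sq P.t_sq P.j

theorem k_sq : P.k ^ 2 = 1 := by
  rw [← cT_j]
  exact conj_sq_eq_one _ P.j_sq

theorem conj_k_apply (x : G) : MulAut.conj P.k x = P.cT (P.cJ (P.cT x)) := by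
  rw [k, conj_mul_apply, conj_mul_apply]

theorem conj_k_root (i k : Fin 3) (c : GF4) :
    MulAut.conj P.k (P.root i k c) = P.root (![0, 2, 1] i) (![0, 2, 1] k) c := by
  rw [conj_k_apply, cT_root, cJ_root, cT_root]
  fin_cases i <;> fin_cases k <;> rfl

theorem conj_k_r : MulAut.conj P.k P.r = P.r⁻¹ := by
  rw [conj_k_apply, cT_r, map_inv, cJ_r, inv_inv, cT_r]

theorem t_eq : P.t = P.j * P.k * P.j := by
  rw [k, ← jtj]
  simp only [← mul_assoc, ← sq, P.j_sq, one_mul]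
  rw [mul_assoc, ← sq, P.j_sq, mul_one]

theorem jkj : P.j * P.k * P.j = P.k * P.j * P.k := by
  rw [← t_eq, ← conj_apply_of_sq P.k_sq, conj_k_apply, cT_j, conj_apply_of_sq P.j_sq,
    ← t_eq]
  exact (conj_eq_self_iff_commute.2 (Commute.refl P.t)).symm

theorem cJ_k : P.cJ P.k = P.k * P.j * P.k := by
  rw [conj_apply_of_sq P.j_sq, jkj]

theorem cJ_root_zero_one_mem_cells (hs : P.s ∈ M) (hr : P.r ∈ M) (c : GF4) :
    P.cJ (P.root 0 1 c) ∈ cells M P.j := by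
  induction c using GF4.induction_on one_ne_zero with
  | zero =>
    rw [root_zero, map_one]
    exact mem_cells_of_mem M.one_mem
  | base =>
    rw [root_zero_one_one, conj_apply_of_sq P.j_sq, jsj]
    exact mul_mul_mem_cells hs hs
  | mul_ζ c ih =>
    have h : P.cJ (P.root 0 1 (GF4.ζ * c)) = P.cR (P.cR (P.cJ (P.root 0 1 c))) := by
      rw [cR_cR_cJ, cR_root]
      rfl
    have cR_mem_cells (x) (hx : x ∈ cells M P.j) : P.cR x ∈ cells M P.j :=
      mem_cells_mul (mul_mem_cells hr hx) (inv_mem hr)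
    rw [h]
    exact cR_mem_cells _ (cR_mem_cells _ ih)

theorem conj_k_root_one_two_mem_cells (hx : P.root 1 2 1 ∈ M) (hr : P.r ∈ M) (c : GF4) :
    MulAut.conj P.k (P.root 1 2 c) ∈ cells M P.k := by
  let f : G →* G := P.cT.toMonoidHom.comp P.cJ.toMonoidHom
  have hfr : f P.r = P.r := by
    change P.cT (P.cJ P.r) = P.r
    rw [cJ_r, map_inv, cT_r, inv_inv]
  have hfj : f P.j = P.k := by
    change P.cT (P.cJ P.j) = P.k
    rw [conj_eq_self_iff_commute.2 (Commute.refl P.j), cT_j]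
  have hf : f (P.cJ (P.root 0 1 c)) = MulAut.conj P.k (P.root 1 2 c) := by
    change P.cT (P.cJ (P.cJ (P.root 0 1 c))) = _
    rw [cJ_cJ, cT_root, conj_k_root]
    rfl
  rw [← hf, ← hfj]
  exact map_mem_cells f (P.cJ_root_zero_one_mem_cells (M := M.comap f) hx
    (Subgroup.mem_comap.2 (hfr.symm ▸ hr)) c)

theorem exists_eq_root_one_two_mul (hx : x ∈ P.borel) :
    ∃ f, ∃ q ∈ P.borel, MulAut.conj P.k q ∈ P.borel ∧ x = P.root 1 2 f * q := by
  obtain ⟨f, d, c, n, rfl⟩ := P.exists_normal_form hx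
  have hr := pow_mem P.r_mem_borel n
  refine ⟨f, P.root 0 2 d * P.root 0 1 c * P.r ^ n, ?_, ?_, by simp only [mul_assoc]⟩
  · exact mul_mem (mul_mem (P.root_zero_two_mem_borel d) (P.root_zero_one_mem_borel c)) hr
  · simp only [map_mul, map_pow, conj_k_root, conj_k_r, Matrix.cons_val]
    rw [inv_pow]
    exact mul_mem (mul_mem (P.root_zero_one_mem_borel d) (P.root_zero_two_mem_borel c)) (inv_mem hr)

theorem exists_eq_mul_root_one_two (hx : x ∈ P.borel) :
    ∃ f, ∃ q ∈ P.borel, MulAut.conj P.k q ∈ P.borel ∧ x = q * P.root 1 2 f := by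
  obtain ⟨f, q, hq, hkq, h⟩ := P.exists_eq_root_one_two_mul (inv_mem hx)
  refine ⟨f, q⁻¹, inv_mem hq, ?_, ?_⟩
  · rw [map_inv]
    exact inv_mem hkq
  · rw [← inv_inv x, h, mul_inv_rev, root_inv]

theorem exists_eq_mul_root_zero_one (hx : x ∈ P.borel) :
    ∃ c, ∃ q ∈ P.borel, P.cJ q ∈ P.borel ∧ x = q * P.root 0 1 c := by
  obtain ⟨f, d, c, n, rfl⟩ := P.exists_normal_form hx
  obtain ⟨c', hc'⟩ := P.exists_root_mul_pow_r 0 1 c n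
  have hr := pow_mem P.r_mem_borel n
  refine ⟨c', P.root 1 2 f * P.root 0 2 d * P.r ^ n, ?_, ?_, by simp only [mul_assoc, hc']⟩
  · exact mul_mem (mul_mem (P.root_one_two_mem_borel f) (P.root_zero_two_mem_borel d)) hr
  · simp only [map_mul, map_pow, cJ_root, cJ_r, Matrix.cons_val]
    rw [inv_pow]
    exact mul_mem (mul_mem (P.root_zero_two_mem_borel f) (P.root_one_two_mem_borel d)) (inv_mem hr)

theorem exists_eq_root_zero_one_mul (hx : x ∈ P.borel) :
    ∃ c, ∃ q ∈ P.borel, P.cJ q ∈ P.borel ∧ x = P.root 0 1 c * q := by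
  obtain ⟨c, q, hq, hjq, h⟩ := P.exists_eq_mul_root_zero_one (inv_mem hx)
  refine ⟨c, q⁻¹, inv_mem hq, ?_, ?_⟩
  · rw [map_inv]
    exact inv_mem hjq
  · rw [← inv_inv x, h, mul_inv_rev, root_inv]

/-- The parabolic subgroup over the Borel subgroup that contains `k`. In `PSL₃(4)` it is the
stabilizer of the point `[1, 0, 0]`. -/
def para : Subgroup G := P.borel ⊔ Subgroup.zpowers P.k

theorem borel_le_para : P.borel ≤ P.para := le_sup_left

theorem k_mem_para : P.k ∈ P.para := Subgroup.mem_sup_right (Subgroup.mem_zpowers P.k)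

theorem r_mem_para : P.r ∈ P.para := P.borel_le_para P.r_mem_borel

theorem root_zero_one_mem_para (c : GF4) : P.root 0 1 c ∈ P.para :=
  P.borel_le_para (P.root_zero_one_mem_borel c)

theorem root_one_two_mem_para (c : GF4) : P.root 1 2 c ∈ P.para :=
  P.borel_le_para (P.root_one_two_mem_borel c)

theorem root_two_one_mem_para (c : GF4) : P.root 2 1 c ∈ P.para := by
  have h : MulAut.conj P.k (P.root 1 2 c) = P.root 2 1 c := P.conj_k_root 1 2 c
  rw [← h, MulAut.conj_apply]
  exact mul_mem (mul_mem P.k_mem_para (P.root_one_two_mem_para c)) (inv_mem P.k_mem_para)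

theorem root_zero_two_mem_para (c : GF4) : P.root 0 2 c ∈ P.para :=
  P.borel_le_para (P.root_zero_two_mem_borel c)

theorem k_eq : P.k = P.root 1 2 1 * P.root 2 1 1 * P.root 1 2 1 := by
  have hj : P.root 0 1 1 * P.root 1 0 1 * P.root 0 1 1 = P.j := by
    have h : P.root 1 0 1 = P.s * P.j * P.s := (conj_apply_of_sq P.j_sq P.s).trans P.jsj
    rw [h, root_zero_one_one]
    simp only [← mul_assoc, ← sq, P.s_sq, one_mul]
    rw [mul_assoc, ← sq, P.s_sq, mul_one]
  have h := congrArg (fun x => P.cT (P.cJ x)) hj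
  simp only [map_mul, cJ_root, cT_root, Matrix.cons_val] at h
  rw [h, conj_eq_self_iff_commute.2 (Commute.refl P.j), cT_j]

theorem para_le (hs : P.s ∈ M) (hr : P.r ∈ M) (h₁₂ : P.root 1 2 1 ∈ M) (h₂₁ : P.root 2 1 1 ∈ M) :
    P.para ≤ M := by
  refine sup_le (P.borel_le hs hr h₁₂) (Subgroup.zpowers_le.2 ?_)
  rw [k_eq]
  exact mul_mem (mul_mem h₁₂ h₂₁) h₁₂

theorem conj_k_mem_cells (hx : x ∈ P.borel) : MulAut.conj P.k x ∈ cells P.borel P.k := by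
  obtain ⟨f, q, -, hq, rfl⟩ := P.exists_eq_root_one_two_mul hx
  rw [map_mul]
  exact mem_cells_mul
    (P.conj_k_root_one_two_mem_cells (P.root_one_two_mem_borel 1) P.r_mem_borel f) hq

theorem para_subset_cells : (P.para : Set G) ⊆ cells P.borel P.k :=
  sup_zpowers_subset_cells P.k_sq fun _ => P.conj_k_mem_cells

theorem cJ_mem_cells_of_mem_borel (hx : x ∈ P.borel) : P.cJ x ∈ cells P.para P.j := by
  obtain ⟨c, q, -, hq, rfl⟩ := P.exists_eq_root_zero_one_mul hx
  rw [map_mul]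
  exact mem_cells_mul
    (P.cJ_root_zero_one_mem_cells (P.root_zero_one_mem_para 1) P.r_mem_para c)
    (P.borel_le_para hq)

theorem exists_eq_mul_k_mul_root (hx : x ∈ P.borel) {y : G} (hy : y ∈ P.borel) :
    ∃ q, P.cJ q ∈ P.borel ∧ ∃ c f, x * P.k * y = q * P.k * (P.root 0 2 c * P.root 1 2 f) := by
  obtain ⟨f, p, -, hp, rfl⟩ := P.exists_eq_mul_root_one_two hy
  obtain ⟨c, q, -, hq, h⟩ := P.exists_eq_mul_root_zero_one (mul_mem hx hp)
  have hc : P.root 0 1 c * P.k = P.k * P.root 0 2 c := by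
    have h := P.conj_k_root 0 2 c
    rw [MulAut.conj_apply, mul_inv_eq_iff_eq_mul] at h
    exact h.symm
  refine ⟨q, hq, c, f, ?_⟩
  calc x * P.k * (p * P.root 1 2 f) = x * MulAut.conj P.k p * P.k * P.root 1 2 f := by
        simp only [MulAut.conj_apply, mul_assoc, inv_mul_cancel_left]
    _ = q * (P.root 0 1 c * P.k) * P.root 1 2 f := by simp only [h, mul_assoc]
    _ = _ := by simp only [hc, mul_assoc]

theorem cJ_mem_cells (hx : x ∈ P.para) : P.cJ x ∈ cells P.para P.j := by
  obtain hx | ⟨a, ha, b, hb, rfl⟩ := mem_cells_iff.1 (P.para_subset_cells hx)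
  · exact P.cJ_mem_cells_of_mem_borel hx
  · obtain ⟨q, hq, c, f, h⟩ := P.exists_eq_mul_k_mul_root ha hb
    have hjx : P.cJ (a * P.k * b) =
        P.cJ q * P.k * P.j * (P.k * (P.root 1 2 c * P.root 0 2 f)) := by
      simp only [h, map_mul, cJ_k, cJ_root, Matrix.cons_val, mul_assoc]
    rw [hjx]
    exact mul_mul_mem_cells (mul_mem (P.borel_le_para hq) P.k_mem_para)
      (mul_mem P.k_mem_para (mul_mem (P.root_one_two_mem_para c) (P.root_zero_two_mem_para f)))

/-- The group generated by all the root elements, which is `PSL₃(4)` when `G` is. -/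
def linear : Subgroup G := P.para ⊔ Subgroup.zpowers P.j

theorem para_le_linear : P.para ≤ P.linear := le_sup_left

theorem j_mem_linear : P.j ∈ P.linear := Subgroup.mem_sup_right (Subgroup.mem_zpowers P.j)

theorem s_mem_linear : P.s ∈ P.linear := P.para_le_linear (P.root_zero_one_mem_para 1)

theorem r_mem_linear : P.r ∈ P.linear := P.para_le_linear P.r_mem_para

theorem t_mem_linear : P.t ∈ P.linear := by
  rw [t_eq]
  exact mul_mem (mul_mem P.j_mem_linear (P.para_le_linear P.k_mem_para)) P.j_mem_linear

theorem linear_le (hs : P.s ∈ M) (hr : P.r ∈ M) (hj : P.j ∈ M) (h₁₂ : P.root 1 2 1 ∈ M)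
    (h₂₁ : P.root 2 1 1 ∈ M) : P.linear ≤ M :=
  sup_le (P.para_le hs hr h₁₂ h₂₁) (Subgroup.zpowers_le.2 hj)

theorem linear_subset_cells : (P.linear : Set G) ⊆ cells P.para P.j :=
  sup_zpowers_subset_cells P.j_sq fun _ => P.cJ_mem_cells

end LinearTuple

/-! ### The extensions by `𝔲`, `𝔳` and `𝔴` -/

section Conjugates

variable {G : Type*} [Group G] {x y : G}

theorem cj_of_sq (hy : y ^ 2 = 1) (x : G) : cj x y = MulAut.conj y x := by
  rw [cj, conj_apply_of_sq hy, inv_eq_self_of_sq hy]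

theorem cj_mul (x y z : G) : cj x (y * z) = cj (cj x y) z := by
  simp only [cj, mul_inv_rev, mul_assoc]

theorem cj_mem {H : Subgroup G} (hx : x ∈ H) (hy : y ∈ H) : cj x y ∈ H :=
  mul_mem (mul_mem (inv_mem hy) hx) hy

end Conjugates

/-- Elements of a group that satisfy the relations among `𝔰, 𝔧, 𝔱, 𝔯, 𝔲, 𝔳, 𝔴` in the
presentation. -/
structure MathieuTuple (G : Type*) [Group G] extends LinearTuple G where
  u : G
  v : G
  w : G
  u_sq : u ^ 2 = 1
  us_sq : (u * s) ^ 2 = 1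
  uj_cube : (u * j) ^ 3 = 1
  ru : cj r u = cj r j
  stu : cj s (t * u) = s * cj s t
  sjtu : cj s (j * t * u) = cj s (j * t) * cj s (t * j * t)
  v_sq : v ^ 2 = 1
  vs_sq : (v * s) ^ 2 = 1
  vu_cube : (v * u) ^ 3 = 1
  vj_sq : (v * j) ^ 2 = 1
  vr_sq : (v * r) ^ 2 = 1
  stv : cj s (t * v) = cj s (t * r)
  sjtv : cj s (j * t * v) = cj s (j * t * r)
  w_sq : w ^ 2 = 1
  wr_sq : (w * r) ^ 2 = 1
  ws_sq : (w * s) ^ 2 = 1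
  wj_sq : (w * j) ^ 2 = 1
  wu_sq : (w * u) ^ 2 = 1
  wst_sq : (w * cj s t) ^ 2 = 1
  wsjt_sq : (w * cj s (j * t)) ^ 2 = 1
  wv_cube : (w * v) ^ 3 = 1

namespace MathieuTuple

variable {G : Type*} [Group G] (P : MathieuTuple G) {x : G}

theorem cj_s_t : cj P.s P.t = P.root 2 1 1 := cj_of_sq P.t_sq P.s

theorem cj_s_jt : cj P.s (P.j * P.t) = P.root 1 2 1 := by
  rw [cj_mul, cj_of_sq P.j_sq, cj_of_sq P.t_sq]
  rfl

theorem cj_s_tjt : cj P.s (P.t * P.j * P.t) = P.root 0 2 1 := by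
  rw [cj_mul, cj_mul, cj_of_sq P.t_sq, cj_of_sq P.j_sq, cj_of_sq P.t_sq]
  rfl

/-- The subgroup generated by `𝔰, 𝔧, 𝔱, 𝔯, 𝔲`, which is `M₂₂` in the Mathieu group. -/
def deg22 : Subgroup G := P.linear ⊔ Subgroup.zpowers P.u

/-- The subgroup generated by `𝔰, 𝔧, 𝔱, 𝔯, 𝔲, 𝔳`, which is `M₂₃` in the Mathieu group. -/
def deg23 : Subgroup G := P.deg22 ⊔ Subgroup.zpowers P.v

/-- The subgroup generated by all the elements of the tuple. -/
def deg24 : Subgroup G := P.deg23 ⊔ Subgroup.zpowers P.w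

theorem linear_le_deg22 : P.linear ≤ P.deg22 := le_sup_left

theorem deg22_le_deg23 : P.deg22 ≤ P.deg23 := le_sup_left

theorem deg23_le_deg24 : P.deg23 ≤ P.deg24 := le_sup_left

theorem u_mem_deg22 : P.u ∈ P.deg22 := Subgroup.mem_sup_right (Subgroup.mem_zpowers P.u)

theorem v_mem_deg23 : P.v ∈ P.deg23 := Subgroup.mem_sup_right (Subgroup.mem_zpowers P.v)

theorem w_mem_deg24 : P.w ∈ P.deg24 := Subgroup.mem_sup_right (Subgroup.mem_zpowers P.w)

theorem conj_u_mem_para (hx : x ∈ P.para) : MulAut.conj P.u x ∈ P.para := by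
  have hu {y} (h : cj y P.u ∈ P.para) : y ∈ P.para.comap (MulAut.conj P.u).toMonoidHom :=
    (cj_of_sq P.u_sq y ▸ h : MulAut.conj P.u y ∈ P.para)
  refine P.para_le (hu ?_) (hu ?_) (hu ?_) (hu ?_) hx
  · rw [cj_of_sq P.u_sq, conj_eq_inv P.u_sq P.us_sq]
    exact inv_mem (P.root_zero_one_mem_para 1)
  · rw [ru, cj_of_sq P.j_sq, P.cJ_r]
    exact inv_mem P.r_mem_para
  · rw [← cj_s_jt, ← cj_mul, sjtu, cj_s_jt, cj_s_tjt]
    exact mul_mem (P.root_one_two_mem_para 1) (P.root_zero_two_mem_para 1)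
  · rw [← cj_s_t, ← cj_mul, stu, cj_s_t]
    exact mul_mem (P.root_zero_one_mem_para 1) (P.root_two_one_mem_para 1)

theorem deg22_subset_cells : (P.deg22 : Set G) ⊆ cells P.linear P.u :=
  sup_zpowers_subset_cells P.u_sq fun _ =>
    conj_mem_cells_of_braid P.para_le_linear P.j_mem_linear P.u_sq P.linear_subset_cells
      (fun _ => P.conj_u_mem_para) (braid_of_cube P.u_sq P.j_sq P.uj_cube)

theorem conj_v_mem_linear (hx : x ∈ P.linear) : MulAut.conj P.v x ∈ P.linear := by
  have hv {y} (h : cj y P.v ∈ P.linear) : y ∈ P.linear.comap (MulAut.conj P.v).toMonoidHom :=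
    (cj_of_sq P.v_sq y ▸ h : MulAut.conj P.v y ∈ P.linear)
  refine P.linear_le (hv ?_) (hv ?_) (hv ?_) (hv ?_) (hv ?_) hx
  · rw [cj_of_sq P.v_sq, conj_eq_inv P.v_sq P.vs_sq]
    exact inv_mem P.s_mem_linear
  · rw [cj_of_sq P.v_sq, conj_eq_inv P.v_sq P.vr_sq]
    exact inv_mem P.r_mem_linear
  · rw [cj_of_sq P.v_sq, conj_eq_inv P.v_sq P.vj_sq]
    exact inv_mem P.j_mem_linear
  · rw [← cj_s_jt, ← cj_mul, sjtv, cj_mul, cj_s_jt]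
    exact cj_mem (P.para_le_linear (P.root_one_two_mem_para 1)) P.r_mem_linear
  · rw [← cj_s_t, ← cj_mul, stv, cj_mul, cj_s_t]
    exact cj_mem (P.para_le_linear (P.root_two_one_mem_para 1)) P.r_mem_linear

theorem deg23_subset_cells : (P.deg23 : Set G) ⊆ cells P.deg22 P.v :=
  sup_zpowers_subset_cells P.v_sq fun _ =>
    conj_mem_cells_of_braid P.linear_le_deg22 P.u_mem_deg22 P.v_sq P.deg22_subset_cells
      (fun _ => P.conj_v_mem_linear) (braid_of_cube P.v_sq P.u_sq P.vu_cube)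

theorem conj_w_mem_deg22 (hx : x ∈ P.deg22) : MulAut.conj P.w x ∈ P.deg22 := by
  have hw {y} (h : (P.w * y) ^ 2 = 1) (hy : y ∈ P.deg22) :
      y ∈ P.deg22.comap (MulAut.conj P.w).toMonoidHom :=
    Subgroup.mem_comap.2 ((conj_eq_inv P.w_sq h).symm ▸ inv_mem hy)
  have of_para {y} (hy : y ∈ P.para) : y ∈ P.deg22 := P.linear_le_deg22 (P.para_le_linear hy)
  have linear_le : P.linear ≤ P.deg22.comap (MulAut.conj P.w).toMonoidHom :=
    P.linear_le (hw P.ws_sq (P.linear_le_deg22 P.s_mem_linear))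
      (hw P.wr_sq (P.linear_le_deg22 P.r_mem_linear))
      (hw P.wj_sq (P.linear_le_deg22 P.j_mem_linear))
      (hw (P.cj_s_jt ▸ P.wsjt_sq) (of_para (P.root_one_two_mem_para 1)))
      (hw (P.cj_s_t ▸ P.wst_sq) (of_para (P.root_two_one_mem_para 1)))
  exact sup_le linear_le (Subgroup.zpowers_le.2 (hw P.wu_sq P.u_mem_deg22)) hx

theorem deg24_subset_cells : (P.deg24 : Set G) ⊆ cells P.deg23 P.w :=
  sup_zpowers_subset_cells P.w_sq fun _ =>
    conj_mem_cells_of_braid P.deg22_le_deg23 P.v_mem_deg23 P.w_sq P.deg23_subset_cells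
      (fun _ => P.conj_w_mem_deg22) (braid_of_cube P.w_sq P.v_sq P.wv_cube)

end MathieuTuple

/-! ### The generating permutations over `GF4` -/

instance : DecidableEq NewPoint := fun p q => by
  cases p <;> cases q <;> first | exact .isTrue rfl | exact .isFalse nofun

instance : Fintype NewPoint where
  elems := {.u, .v, .w}
  complete p := by cases p <;> decide

/-- The points `[1, y, z]`, `[0, 1, z]` and `[0, 0, 1]` of the projective plane over `GF4`. They are
encoded by first-order data, rather than as functions, so that the kernel can enumerate them. -/
abbrev ModelPlane : Type := GF4 × GF4 ⊕ GF4 ⊕ Unit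

namespace ModelPlane

/-- The homogeneous coordinates of a point, normalised so that the first nonzero one is `1`. -/
def coords : ModelPlane → Fin 3 → GF4
  | .inl (y, z) => ![1, y, z]
  | .inr (.inl z) => ![0, 1, z]
  | .inr (.inr _) => ![0, 0, 1]

/-- The point with given homogeneous coordinates. The value at `0` is junk. -/
def ofCoords (p : Fin 3 → GF4) : ModelPlane :=
  if p 0 ≠ 0 then .inl (p 1 / p 0, p 2 / p 0)
  else if p 1 ≠ 0 then .inr (.inl (p 2 / p 1))
  else .inr (.inr ())

theorem coords_ne_zero : ∀ x, coords x ≠ 0 := by decide +kernel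

theorem ofCoords_coords : ∀ x, ofCoords (coords x) = x := by decide +kernel

theorem ofCoords_smul : ∀ (a : GF4) (p : Fin 3 → GF4), a ≠ 0 → ofCoords (a • p) = ofCoords p := by
  decide +kernel

theorem exists_smul_eq_coords_ofCoords :
    ∀ p : Fin 3 → GF4, p ≠ 0 → ∃ a : GF4, a • p = coords (ofCoords p) := by
  decide +kernel

end ModelPlane

/-- The 24 points over `GF4`. -/
abbrev ModelPoint : Type := ModelPlane ⊕ NewPoint

/-- The action of a generating symbol on homogeneous coordinates. -/
def genCoord : Gen → (Fin 3 → GF4) → Fin 3 → GF4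
  | .s, p => ![p 0 + p 1, p 1, p 2]
  | .j, p => ![p 1, p 0, p 2]
  | .t, p => ![p 2, p 1, p 0]
  | .r, p => ![GF4.ζ * p 0, p 1, GF4.ζ⁻¹ * p 2]
  | .u, p => ![p 0 ^ 2 + p 1 * p 2, p 1 ^ 2, p 2 ^ 2]
  | .v, p => ![p 0 ^ 2, p 1 ^ 2, GF4.ζ * p 2 ^ 2]
  | .w, p => ![p 0 ^ 2, p 1 ^ 2, p 2 ^ 2]

/-- The interchange of two points involved in the permutation named by a generating symbol. -/
def genSwap : Gen → Equiv.Perm ModelPoint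
  | .u => Equiv.swap (.inl (.inl (0, 0))) (.inr .u)
  | .v => Equiv.swap (.inr .u) (.inr .v)
  | .w => Equiv.swap (.inr .v) (.inr .w)
  | .s | .j | .t | .r => 1

/-- The map of the 24 points over `GF4` named by a generating symbol. -/
def genMap (g : Gen) (x : ModelPoint) : ModelPoint :=
  genSwap g (Sum.map (ModelPlane.ofCoords ∘ genCoord g ∘ ModelPlane.coords) id x)

/-- The permutation of the 24 points over `GF4` named by a generating symbol. It is an involution
except for `𝔯`, which has order `3`. -/
def modelPerm (g : Gen) : Equiv.Perm ModelPoint where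
  toFun := genMap g
  invFun := (genMap g)^[match g with
    | .r => 2
    | _ => 1]
  left_inv := by cases g <;> (unfold Function.LeftInverse; decide +kernel)
  right_inv := by cases g <;> (unfold Function.RightInverse Function.LeftInverse; decide +kernel)

theorem rels_modelPerm : ∀ x ∈ relsM24, FreeGroup.lift modelPerm x = 1 := by
  simp only [relsM24, relsPSL34, relsU, relsV, relsW, Set.mem_union, or_imp, forall_and,
    Set.forall_mem_insert, Set.mem_singleton_iff, forall_eq, cj, s, j, t, r, u, v, w, map_mul,
    map_pow, map_inv, FreeGroup.lift_apply_of]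
  split_ands <;> exact Equiv.ext (by decide +kernel)

/-! ### Coordinates over `GF(4)` -/

namespace GF4

/-- The Frobenius automorphism. -/
def frobenius : GF4 ≃+* GF4 where
  toFun c := c ^ 2
  invFun c := c ^ 2
  left_inv := by unfold Function.LeftInverse; decide
  right_inv := by unfold Function.RightInverse Function.LeftInverse; decide
  map_mul' := by decide
  map_add' := by decide

theorem exists_ringEquiv {ζ : F4ˣ} (hζ : ∀ x : F4ˣ, x ∈ Subgroup.zpowers ζ) :
    ∃ e : GF4 ≃+* F4, e GF4.ζ = ζ := by
  have := Fintype.ofFinite F4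
  have card_eq : Fintype.card GF4 = Fintype.card F4 := by
    rw [← Nat.card_eq_fintype_card (α := F4), GaloisField.card 2 2 two_ne_zero]
    rfl
  obtain ⟨e⟩ : Nonempty (GF4 ≃+* F4) := ⟨FiniteField.ringEquivOfCardEq card_eq⟩
  have ζ_ne_one : ζ ≠ 1 := by
    rintro rfl
    have h := hζ (Units.mk0 (e GF4.ζ) ((map_ne_zero e).2 (by decide)))
    rw [Subgroup.zpowers_one_eq_bot, Subgroup.mem_bot, Units.ext_iff, Units.val_mk0, Units.val_one,
      map_eq_one_iff e e.injective] at h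
    exact absurd h (by decide)
  obtain ⟨c, hc⟩ := e.surjective ζ
  have c_ne_zero : c ≠ 0 := by
    rintro rfl
    exact ζ.ne_zero (hc.symm.trans (map_zero e))
  have c_ne_one : c ≠ 1 := by
    rintro rfl
    exact ζ_ne_one (Units.ext (hc.symm.trans (map_one e)))
  have eq_ζ_or : ∀ c : GF4, c ≠ 0 → c ≠ 1 → c = GF4.ζ ∨ c = frobenius GF4.ζ := by decide
  obtain rfl | rfl := eq_ζ_or c c_ne_zero c_ne_one
  · exact ⟨e, hc⟩
  · exact ⟨frobenius.trans e, hc⟩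

end GF4

namespace MathieuTuple

variable {G : Type*} [Group G]

/-- The element of a tuple named by a generating symbol. -/
def gen (P : MathieuTuple G) : Gen → G
  | .s => P.s
  | .j => P.j
  | .t => P.t
  | .r => P.r
  | .u => P.u
  | .v => P.v
  | .w => P.w

/-- The tuple of images of the generating symbols under a map that respects the relations. -/
def ofGen (f : Gen → G) (hf : ∀ x ∈ relsM24, FreeGroup.lift f x = 1) : MathieuTuple G := by
  simp only [relsM24, relsPSL34, relsU, relsV, relsW, Set.mem_union, or_imp, forall_and,
    Set.forall_mem_insert, Set.mem_singleton_iff, forall_eq, cj, s, j, t, r, Mathieu.u, Mathieu.v,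
    Mathieu.w, map_mul, map_pow, map_inv, FreeGroup.lift_apply_of, mul_inv_eq_one] at hf
  have hL := hf.1.1.1
  have hU := hf.1.1.2
  have hV := hf.1.2
  have hW := hf.2
  exact
    { s := f .s, j := f .j, t := f .t, r := f .r, u := f .u, v := f .v, w := f .w
      s_sq := hL.1, j_sq := hL.2.1, t_sq := hL.2.2.1, r_cube := hL.2.2.2.1, jr_sq := hL.2.2.2.2.1
      tr_sq := hL.2.2.2.2.2.1, sr_cube := hL.2.2.2.2.2.2.1, js_cube := hL.2.2.2.2.2.2.2.1
      tj_cube := hL.2.2.2.2.2.2.2.2.1, tstjs_cube := hL.2.2.2.2.2.2.2.2.2.1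
      long := hL.2.2.2.2.2.2.2.2.2.2
      u_sq := hU.1, us_sq := hU.2.1, uj_cube := hU.2.2.1, ru := hU.2.2.2.1, stu := hU.2.2.2.2.1
      sjtu := hU.2.2.2.2.2
      v_sq := hV.1, vs_sq := hV.2.1, vu_cube := hV.2.2.1, vj_sq := hV.2.2.2.1
      vr_sq := hV.2.2.2.2.1, stv := hV.2.2.2.2.2.1, sjtv := hV.2.2.2.2.2.2
      w_sq := hW.1, wr_sq := hW.2.1, ws_sq := hW.2.2.1, wj_sq := hW.2.2.2.1, wu_sq := hW.2.2.2.2.1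
      wst_sq := hW.2.2.2.2.2.1, wsjt_sq := hW.2.2.2.2.2.2.1, wv_cube := hW.2.2.2.2.2.2.2 }

theorem gen_ofGen (f : Gen → G) (hf : ∀ x ∈ relsM24, FreeGroup.lift f x = 1) (g : Gen) :
    (ofGen f hf).gen g = f g := by
  cases g <;> rfl

theorem closure_range_gen_le_deg24 (P : MathieuTuple G) :
    Subgroup.closure (Set.range P.gen) ≤ P.deg24 := by
  rw [Subgroup.closure_le]
  have linear_le : P.linear ≤ P.deg24 :=
    P.linear_le_deg22.trans (P.deg22_le_deg23.trans P.deg23_le_deg24)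
  rintro _ ⟨g | _, rfl⟩
  exacts [linear_le P.s_mem_linear, linear_le P.j_mem_linear, linear_le P.t_mem_linear,
    linear_le P.r_mem_linear, P.deg23_le_deg24 (P.deg22_le_deg23 P.u_mem_deg22),
    P.deg23_le_deg24 P.v_mem_deg23, P.w_mem_deg24]

end MathieuTuple

theorem LinearTuple.map_root {G H : Type*} [Group G] [Group H] {P : LinearTuple G}
    {Q : LinearTuple H} {φ : G →* H} (hs : φ P.s = Q.s) (hj : φ P.j = Q.j) (ht : φ P.t = Q.t)
    (hr : φ P.r = Q.r) (i k : Fin 3) (c : GF4) : φ (P.root i k c) = Q.root i k c := by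
  have map_baseRoot : φ (P.baseRoot c) = Q.baseRoot c := by
    cases c <;> simp only [baseRoot, MulAut.conj_apply, map_mul, map_inv, map_one, hs, hr]
  fin_cases i <;> fin_cases k <;>
    simp only [root, MulAut.conj_apply, map_mul, map_inv, map_one, hj, ht, map_baseRoot]

/-- The tuple of generating permutations over `GF4`. -/
def modelTuple : MathieuTuple (Equiv.Perm ModelPoint) :=
  .ofGen modelPerm rels_modelPerm

/-- One reads off `f` and `d` from the image of `[0, 0, 1]`, then `c` from that of `[0, 1, 0]`, and
finally `n` from that of `[1, 1, 1]`. -/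
theorem modelTuple_normal_form_faithful : ∀ (f d c : GF4) (n : Fin 3),
    modelTuple.root 1 2 f * modelTuple.root 0 2 d * modelTuple.root 0 1 c *
      modelTuple.r ^ (n : ℕ) = 1 → f = 0 ∧ d = 0 ∧ c = 0 ∧ n = 0 := by
  simp only [Equiv.ext_iff]
  decide +kernel

/-! ### Faithfulness of the action on the 24 points -/

namespace ModelPoint

/-- The point `[1, 0, 0]`. -/
def e₀ : ModelPoint := .inl (.inl (0, 0))

/-- The line `{[x, y, 0]}`. -/
def line₀₁ : Finset ModelPoint :=
  insert (.inl (.inr (.inl 0))) (Finset.univ.image fun y : GF4 => .inl (.inl (y, 0)))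

end ModelPoint

open MulAction (stabilizer mem_stabilizer_iff)
open scoped Pointwise
open ModelPoint

namespace MathieuTuple

variable {G : Type*} [Group G] {P : MathieuTuple G} {φ : G →* Equiv.Perm ModelPoint} {x : G}
  (hφ : ∀ g, φ (P.gen g) = modelPerm g)

include hφ

theorem map_root (i k : Fin 3) (c : GF4) : φ (P.root i k c) = modelTuple.root i k c :=
  LinearTuple.map_root (hφ .s) (hφ .j) (hφ .t) (hφ .r) i k c

variable {X : Type*} [MulAction (Equiv.Perm ModelPoint) X] {a : X}

theorem gen_mem_stabilizer_iff {g : Gen} :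
    P.gen g ∈ (stabilizer (Equiv.Perm ModelPoint) a).comap φ ↔ modelPerm g • a = a := by
  rw [Subgroup.mem_comap, hφ, mem_stabilizer_iff]

theorem root_mem_stabilizer_iff {i k : Fin 3} {c : GF4} :
    P.root i k c ∈ (stabilizer (Equiv.Perm ModelPoint) a).comap φ ↔
      modelTuple.root i k c • a = a := by
  rw [Subgroup.mem_comap, map_root hφ, mem_stabilizer_iff]

theorem borel_le_stabilizer : P.borel ≤ (stabilizer (Equiv.Perm ModelPoint) line₀₁).comap φ :=
  P.borel_le ((gen_mem_stabilizer_iff hφ (g := .s)).2 (by decide +kernel))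
    ((gen_mem_stabilizer_iff hφ (g := .r)).2 (by decide +kernel))
    ((root_mem_stabilizer_iff hφ).2 (by decide +kernel))

theorem k_notMem_stabilizer : P.k ∉ (stabilizer (Equiv.Perm ModelPoint) line₀₁).comap φ := by
  have k_eq_gen : P.k = P.gen .t * P.gen .j * P.gen .t := rfl
  rw [Subgroup.mem_comap, k_eq_gen, map_mul, map_mul, hφ, hφ, mem_stabilizer_iff]
  decide +kernel

theorem para_le_stabilizer : P.para ≤ (stabilizer (Equiv.Perm ModelPoint) e₀).comap φ :=
  P.para_le ((gen_mem_stabilizer_iff hφ (g := .s)).2 (by decide +kernel))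
    ((gen_mem_stabilizer_iff hφ (g := .r)).2 (by decide +kernel))
    ((root_mem_stabilizer_iff hφ).2 (by decide +kernel))
    ((root_mem_stabilizer_iff hφ).2 (by decide +kernel))

theorem linear_le_stabilizer (p : NewPoint) :
    P.linear ≤ (stabilizer (Equiv.Perm ModelPoint) (Sum.inr p : ModelPoint)).comap φ :=
  P.linear_le ((gen_mem_stabilizer_iff hφ (g := .s)).2 (by decide +kernel +revert))
    ((gen_mem_stabilizer_iff hφ (g := .r)).2 (by decide +kernel +revert))
    ((gen_mem_stabilizer_iff hφ (g := .j)).2 (by decide +kernel +revert))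
    ((root_mem_stabilizer_iff hφ).2 (by decide +kernel +revert))
    ((root_mem_stabilizer_iff hφ).2 (by decide +kernel +revert))

theorem deg22_le_stabilizer {p : NewPoint} (hp : p ≠ .u) :
    P.deg22 ≤ (stabilizer (Equiv.Perm ModelPoint) (Sum.inr p : ModelPoint)).comap φ :=
  sup_le (linear_le_stabilizer hφ p) <| Subgroup.zpowers_le.2 <|
    (gen_mem_stabilizer_iff hφ (g := .u)).2 (by decide +kernel +revert)

theorem deg23_le_stabilizer :
    P.deg23 ≤ (stabilizer (Equiv.Perm ModelPoint) (Sum.inr .w : ModelPoint)).comap φ :=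
  sup_le (deg22_le_stabilizer hφ (by decide)) <| Subgroup.zpowers_le.2 <|
    (gen_mem_stabilizer_iff hφ (g := .v)).2 (by decide +kernel)

theorem eq_one_of_mem_borel (hx : x ∈ P.borel) (hφx : φ x = 1) : x = 1 := by
  obtain ⟨f, d, c, n, rfl⟩ := P.exists_normal_form hx
  have map_r : φ P.r = modelTuple.r := hφ .r
  rw [map_mul, map_mul, map_mul, map_pow, map_root hφ, map_root hφ, map_root hφ, map_r,
    pow_eq_pow_mod n modelTuple.r_cube] at hφx
  obtain ⟨rfl, rfl, rfl, hn⟩ :=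
    modelTuple_normal_form_faithful f d c ⟨n % 3, n.mod_lt three_pos⟩ hφx
  rw [pow_eq_pow_mod n P.r_cube, Fin.mk.inj_iff.1 hn, P.root_zero, P.root_zero, P.root_zero,
    pow_zero]
  simp only [mul_one]

theorem eq_one_of_mem_deg24 (hx : x ∈ P.deg24) (hφx : φ x = 1) : x = 1 := by
  have mem_stabilizer {X : Type} [MulAction (Equiv.Perm ModelPoint) X] (a : X) :
      x ∈ (stabilizer (Equiv.Perm ModelPoint) a).comap φ := by
    rw [Subgroup.mem_comap, hφx]
    exact one_mem _
  have mem_deg23 : x ∈ P.deg23 :=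
    mem_of_mem_cells (deg23_le_stabilizer hφ)
      ((gen_mem_stabilizer_iff hφ (g := .w)).not.2 (by decide +kernel)) (mem_stabilizer _)
      (P.deg24_subset_cells hx)
  have mem_deg22 : x ∈ P.deg22 :=
    mem_of_mem_cells (deg22_le_stabilizer hφ (p := .v) (by decide))
      ((gen_mem_stabilizer_iff hφ (g := .v)).not.2 (by decide +kernel)) (mem_stabilizer _)
      (P.deg23_subset_cells mem_deg23)
  have mem_linear : x ∈ P.linear :=
    mem_of_mem_cells (linear_le_stabilizer hφ .u)
      ((gen_mem_stabilizer_iff hφ (g := .u)).not.2 (by decide +kernel)) (mem_stabilizer _)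
      (P.deg22_subset_cells mem_deg22)
  have mem_para : x ∈ P.para :=
    mem_of_mem_cells (para_le_stabilizer hφ)
      ((gen_mem_stabilizer_iff hφ (g := .j)).not.2 (by decide +kernel)) (mem_stabilizer _)
      (P.linear_subset_cells mem_linear)
  have mem_borel : x ∈ P.borel :=
    mem_of_mem_cells (borel_le_stabilizer hφ) (k_notMem_stabilizer hφ) (mem_stabilizer _)
      (P.para_subset_cells mem_para)
  exact eq_one_of_mem_borel hφ mem_borel hφx

end MathieuTuple

/-! ### Transfer to the projective plane over `GF(4)` -/

section RingEquivComp

variable {R S ι : Type*} [NonAssocSemiring R] [NonAssocSemiring S] (e : R ≃+* S)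

theorem ringEquiv_comp_ne_zero {p : ι → R} (hp : p ≠ 0) : e ∘ p ≠ 0 := fun h =>
  hp (funext fun i => (map_eq_zero_iff e e.injective).1 (congrFun h i))

theorem ringEquiv_comp_smul (a : R) (p : ι → R) : e ∘ (a • p) = e a • (e ∘ p) :=
  funext fun i => map_mul e a (p i)

theorem ringEquiv_symm_comp_comp (p : ι → R) : e.symm ∘ e ∘ p = p :=
  funext fun i => e.symm_apply_apply (p i)

end RingEquivComp

section Transfer

variable (e : GF4 ≃+* F4)

/-- The identification of the points over `GF4` with the projective plane over `GF(4)`. -/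
def planeEquiv : ModelPlane ≃ Plane where
  toFun x := Projectivization.mk F4 (e ∘ x.coords) (ringEquiv_comp_ne_zero e x.coords_ne_zero)
  invFun := Projectivization.lift (fun p => ModelPlane.ofCoords (e.symm ∘ p.1)) (by
    rintro ⟨p, hp⟩ ⟨q, hq⟩ a rfl
    have a_ne_zero : a ≠ 0 := by
      rintro rfl
      exact hp (zero_smul F4 q)
    rw [ringEquiv_comp_smul, ModelPlane.ofCoords_smul _ _ ((map_ne_zero e.symm).2 a_ne_zero)])
  left_inv x := by
    rw [Projectivization.lift_mk, ringEquiv_symm_comp_comp, x.ofCoords_coords]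
  right_inv x := by
    induction x using Projectivization.ind with
    | h p hp =>
      obtain ⟨a, ha⟩ := ModelPlane.exists_smul_eq_coords_ofCoords (e.symm ∘ p)
        (ringEquiv_comp_ne_zero e.symm hp)
      rw [Projectivization.lift_mk, Projectivization.mk_eq_mk_iff', ← ha, ringEquiv_comp_smul]
      exact ⟨e a, congrArg (e a • ·) (ringEquiv_symm_comp_comp e.symm p).symm⟩

theorem mk_comp_eq {p : Fin 3 → GF4} (h : e ∘ p ≠ 0) :
    Projectivization.mk F4 (e ∘ p) h = planeEquiv e (ModelPlane.ofCoords p) := by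
  rw [← Equiv.symm_apply_eq]
  exact congrArg ModelPlane.ofCoords (ringEquiv_symm_comp_comp e p)

/-- The identification of the 24 points over `GF4` with those over `GF(4)`. -/
def pointEquiv : ModelPoint ≃ Point24 :=
  (planeEquiv e).sumCongr (Equiv.refl NewPoint)

variable {e} {g : Gen} {σ : Equiv.Perm Plane} {f : (Fin 3 → F4) → Fin 3 → F4}

theorem extendPerm_pointEquiv
    (hσ : ∀ p hp, ∃ h, σ (Projectivization.mk F4 p hp) = Projectivization.mk F4 (f p) h)
    (hf : ∀ p, f (e ∘ p) = e ∘ genCoord g p) (x : ModelPoint) :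
    extendPerm σ (pointEquiv e x) =
      pointEquiv e (x.map (ModelPlane.ofCoords ∘ genCoord g ∘ ModelPlane.coords) id) := by
  obtain x | x := x
  · refine congrArg Sum.inl ?_
    obtain ⟨h, hx⟩ := hσ _ (ringEquiv_comp_ne_zero e x.coords_ne_zero)
    simp only [hf] at h hx
    exact hx.trans (mk_comp_eq e h)
  · rfl

theorem pointEquiv_modelPerm {τ : Equiv.Perm Point24}
    (hσ : ∀ p hp, ∃ h, σ (Projectivization.mk F4 p hp) = Projectivization.mk F4 (f p) h)
    (hf : ∀ p, f (e ∘ p) = e ∘ genCoord g p) (hτ : τ = (pointEquiv e).permCongr (genSwap g)) :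
    τ * extendPerm σ = (pointEquiv e).permCongr (modelPerm g) := by
  refine (Equiv.symm_apply_eq _).1 (Equiv.ext fun x => ?_)
  rw [Equiv.permCongr_symm_apply, Equiv.Perm.mul_apply, extendPerm_pointEquiv hσ hf, hτ,
    Equiv.permCongr_apply, Equiv.symm_apply_apply, Equiv.symm_apply_apply]
  rfl

theorem pslHom_eq {M : Matrix.SpecialLinearGroup (Fin 3) F4}
    (hM : ∀ p, M.1.mulVec (e ∘ p) = e ∘ genCoord g p) (hg : genSwap g = 1) :
    pslHom (M : PSL34) = (pointEquiv e).permCongr (modelPerm g) := by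
  rw [← pointEquiv_modelPerm (σ := Projectivization.PSLAction.toPermHom (M : PSL34)) (τ := 1)
    (fun p hp => ⟨(smul_ne_zero_iff_ne M).2 hp, rfl⟩) hM (by rw [hg]; ext; simp), one_mul]
  rfl

theorem swap_mul_coordPerm_eq {f : (Fin 3 → F4) → Fin 3 → F4} {hs hinv} {_ : DecidableEq Point24}
    {a b : ModelPoint} {a' b' : Point24} (hg : genSwap g = Equiv.swap a b)
    (ha : a' = pointEquiv e a) (hb : b' = pointEquiv e b)
    (hf : ∀ p, f (e ∘ p) = e ∘ genCoord g p) :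
    Equiv.swap a' b' * extendPerm (coordPerm f hs hinv) =
      (pointEquiv e).permCongr (modelPerm g) :=
  pointEquiv_modelPerm (fun p hp => ⟨ne_zero_of_involutive f hs hinv p hp, rfl⟩) hf
    (by rw [hg, ha, hb]; exact (Equiv.symm_trans_swap_trans a b (pointEquiv e)).symm)

theorem q2_eq : Sum.inl q2 = pointEquiv e ModelPoint.e₀ := by
  have coords_eq : e ∘ ModelPlane.coords (.inl (0, 0)) = ![1, 0, 0] := by
    ext i
    fin_cases i <;> simp [ModelPlane.coords]
  exact congrArg Sum.inl (by simp only [q2, planeEquiv, Equiv.coe_fn_mk, coords_eq])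

theorem genPerm_eq {ζ : F4ˣ} (he : e GF4.ζ = ζ) (g : Gen) :
    genPerm ζ g = (pointEquiv e).permCongr (modelPerm g) := by
  cases g
  case s | j | t | r =>
    refine pslHom_eq (fun p => ?_) rfl
    ext i
    fin_cases i <;>
      simp [matS, matJ, matT, matR, genCoord, Matrix.mulVec, dotProduct, Fin.sum_univ_three, he]
  case u =>
    refine swap_mul_coordPerm_eq rfl q2_eq rfl (fun p => ?_)
    ext i
    fin_cases i <;> simp [genCoord]
  case v =>
    refine swap_mul_coordPerm_eq rfl rfl rfl (fun p => ?_)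
    ext i
    fin_cases i <;> simp [genCoord, he]
  case w =>
    refine swap_mul_coordPerm_eq rfl rfl rfl (fun p => ?_)
    ext i
    fin_cases i <;> simp [genCoord]

end Transfer

theorem lift_genPerm {ζ : F4ˣ} {e : GF4 ≃+* F4} (he : e GF4.ζ = ζ) :
    FreeGroup.lift (genPerm ζ) =
      (pointEquiv e).permCongrHom.toMonoidHom.comp (FreeGroup.lift modelPerm) := by
  ext1 g
  simpa using genPerm_eq he g

theorem rels_genPerm {ζ : F4ˣ} (hζ : ∀ x : F4ˣ, x ∈ Subgroup.zpowers ζ) :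
    ∀ x ∈ relsM24, FreeGroup.lift (genPerm ζ) x = 1 := by
  intro x hx
  obtain ⟨e, he⟩ := GF4.exists_ringEquiv hζ
  rw [lift_genPerm he, MonoidHom.comp_apply, rels_modelPerm x hx, map_one]

theorem toGroup_rels_modelPerm_injective :
    Function.Injective (PresentedGroup.toGroup rels_modelPerm) := by
  let P : MathieuTuple (PresentedGroup relsM24) := .ofGen PresentedGroup.of fun x hx => by
    have lift_of : FreeGroup.lift PresentedGroup.of = PresentedGroup.mk relsM24 := by
      ext1 g
      exact FreeGroup.lift_apply_of
    rw [lift_of, PresentedGroup.one_of_mem hx]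
  have gen_eq : P.gen = PresentedGroup.of := funext (MathieuTuple.gen_ofGen _ _)
  have deg24_eq_top : P.deg24 = ⊤ := by
    rw [← top_le_iff, ← PresentedGroup.closure_range_of, ← gen_eq]
    exact P.closure_range_gen_le_deg24
  refine (injective_iff_map_eq_one _).2 fun x hx => ?_
  refine MathieuTuple.eq_one_of_mem_deg24 (P := P) (fun g => ?_)
    (deg24_eq_top ▸ Subgroup.mem_top x) hx
  rw [gen_eq, PresentedGroup.toGroup.of]

theorem toGroup_rels_genPerm_injective {ζ : F4ˣ} (hζ : ∀ x : F4ˣ, x ∈ Subgroup.zpowers ζ) :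
    Function.Injective (PresentedGroup.toGroup (rels_genPerm hζ)) := by
  obtain ⟨e, he⟩ := GF4.exists_ringEquiv hζ
  have toGroup_eq : PresentedGroup.toGroup (rels_genPerm hζ) =
      (pointEquiv e).permCongrHom.toMonoidHom.comp (PresentedGroup.toGroup rels_modelPerm) := by
    ext1 g
    simpa using genPerm_eq he g
  rw [toGroup_eq]
  exact (pointEquiv e).permCongrHom.injective.comp toGroup_rels_modelPerm_injective

/-! ### Generation of `SL₃(4)` -/

open Matrix (SpecialLinearGroup)
open Matrix.SpecialLinearGroup (transvection transvection_coe transvection_coeff_zero diag2n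
  diag2n_coe)

section PermSL

variable {ι R F : Type*} [Fintype ι] [DecidableEq ι] [CommRing R] [CharP R 2] [Field F] [CharP F 2]

variable (ι R) in
/-- The permutation matrices. In characteristic `2` they all have determinant `1`. -/
def permSL : Equiv.Perm ι →* SpecialLinearGroup ι R where
  toFun σ := ⟨Matrix.permMatrixHom σ, by
    rw [Matrix.permMatrixHom_apply, Matrix.det_permutation]
    obtain h | h := Int.units_eq_one_or (Equiv.Perm.sign σ⁻¹) <;> simp [h, CharTwo.neg_eq]⟩
  map_one' := Subtype.ext (map_one Matrix.permMatrixHom)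
  map_mul' σ τ := Subtype.ext (map_mul Matrix.permMatrixHom σ τ)

theorem coe_permSL (σ : Equiv.Perm ι) : (permSL ι R σ).1 = σ⁻¹.permMatrix R := rfl

theorem coe_permSL_conj (σ : Equiv.Perm ι) (A : SpecialLinearGroup ι R) :
    (permSL ι R σ * A * (permSL ι R σ)⁻¹).1 = A.1.submatrix σ.symm σ.symm := by
  rw [← map_inv, Matrix.SpecialLinearGroup.coe_mul, Matrix.SpecialLinearGroup.coe_mul, coe_permSL,
    coe_permSL, PEquiv.toMatrix_toPEquiv_mul, PEquiv.mul_toMatrix_toPEquiv]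
  rfl

theorem permSL_conj_transvection (σ : Equiv.Perm ι) {i j : ι} (hij : i ≠ j) (c : R) :
    permSL ι R σ * transvection hij c * (permSL ι R σ)⁻¹ =
      transvection (σ.injective.ne hij) c := by
  apply Subtype.ext
  rw [coe_permSL_conj]
  ext a b
  simp [transvection_coe, Matrix.one_apply, Matrix.single_apply, Equiv.eq_symm_apply]

theorem permSL_conj_diag2n (σ : Equiv.Perm ι) {i j : ι} (hij : i ≠ j) (c : F) (hc : c ≠ 0) :
    permSL ι F σ * diag2n hij c hc * (permSL ι F σ)⁻¹ = diag2n (σ.injective.ne hij) c hc := by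
  apply Subtype.ext
  rw [coe_permSL_conj]
  ext a b
  simp [diag2n_coe, Matrix.diagonal_apply, Equiv.symm_apply_eq]

end PermSL

theorem matS_eq_transvection : matS = transvection (i := 0) (j := 1) (by decide) 1 := by
  ext a b
  fin_cases a <;> fin_cases b <;> simp [matS, transvection_coe]

theorem matJ_eq_permSL : matJ = permSL (Fin 3) F4 (Equiv.swap 0 1) := by
  ext a b
  fin_cases a <;> fin_cases b <;> simp [matJ, coe_permSL, Equiv.swap_apply_def]

theorem matT_eq_permSL : matT = permSL (Fin 3) F4 (Equiv.swap 0 2) := by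
  ext a b
  fin_cases a <;> fin_cases b <;> simp [matT, coe_permSL, Equiv.swap_apply_def]

theorem coe_matR (a : F4ˣ) : (matR a).1 = !![(a : F4), 0, 0; 0, 1, 0; 0, 0, (a⁻¹ : F4ˣ)] := rfl

theorem matR_eq_diag2n (a : F4ˣ) :
    matR a = diag2n (i := 0) (j := 2) (by decide) (a : F4) a.ne_zero := by
  ext b c
  fin_cases b <;> fin_cases c <;> simp [coe_matR, diag2n_coe]

/-- `matR` as a homomorphism. -/
def torusHom : F4ˣ →* SpecialLinearGroup (Fin 3) F4 where
  toFun := matR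
  map_one' := by
    ext i k
    fin_cases i <;> fin_cases k <;> simp [coe_matR]
  map_mul' a b := by
    ext i k
    fin_cases i <;> fin_cases k <;>
      simp [coe_matR, Matrix.mul_apply, Fin.sum_univ_three, mul_comm]

theorem matR_conj_transvection (a : F4ˣ) (c : F4) :
    matR a * transvection (i := 0) (j := 1) (by decide) c * (matR a)⁻¹ =
      transvection (i := 0) (j := 1) (by decide) (a * c) := by
  rw [mul_inv_eq_iff_eq_mul]
  ext i k
  fin_cases i <;> fin_cases k <;>
    simp [coe_matR, transvection_coe, Matrix.mul_apply, Fin.sum_univ_three]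

section Generation

variable {N : Subgroup (SpecialLinearGroup (Fin 3) F4)} {ζ : F4ˣ}

theorem permSL_mem (hj : matJ ∈ N) (ht : matT ∈ N) (σ : Equiv.Perm (Fin 3)) :
    permSL (Fin 3) F4 σ ∈ N := by
  have eq_pow_mul : ∀ σ : Equiv.Perm (Fin 3), ∃ a b c : Fin 2,
      σ = Equiv.swap 0 1 ^ (a : ℕ) * Equiv.swap 0 2 ^ (b : ℕ) * Equiv.swap 0 1 ^ (c : ℕ) := by
    decide
  obtain ⟨a, b, c, rfl⟩ := eq_pow_mul σ
  rw [map_mul, map_mul, map_pow, map_pow, map_pow, ← matJ_eq_permSL, ← matT_eq_permSL]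
  exact mul_mem (mul_mem (pow_mem hj _) (pow_mem ht _)) (pow_mem hj _)

variable (hζ : ∀ x : F4ˣ, x ∈ Subgroup.zpowers ζ)

include hζ

theorem matR_mem (hr : matR ζ ∈ N) (a : F4ˣ) : matR a ∈ N := by
  obtain ⟨n, rfl⟩ := hζ a
  change torusHom (ζ ^ n) ∈ N
  rw [map_zpow]
  exact zpow_mem hr n

theorem transvection_zero_one_mem (hs : matS ∈ N) (hr : matR ζ ∈ N) (c : F4) :
    transvection (i := 0) (j := 1) (by decide) c ∈ N := by
  obtain rfl | hc := eq_or_ne c 0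
  · rw [transvection_coeff_zero]
    exact one_mem N
  · have h := matR_conj_transvection (Units.mk0 c hc) 1
    rw [← matS_eq_transvection, Units.val_mk0, mul_one] at h
    exact h ▸ mul_mem (mul_mem (matR_mem hζ hr _) hs) (inv_mem (matR_mem hζ hr _))

theorem eq_top_of_generators_mem (hs : matS ∈ N) (hj : matJ ∈ N) (ht : matT ∈ N)
    (hr : matR ζ ∈ N) : N = ⊤ := by
  have exists_perm : ∀ a b i k : Fin 3, a ≠ b → i ≠ k →
      ∃ σ : Equiv.Perm (Fin 3), σ a = i ∧ σ b = k := by decide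
  have conj_mem {σ : Equiv.Perm (Fin 3)} {A : SpecialLinearGroup (Fin 3) F4} (hA : A ∈ N) :
      permSL (Fin 3) F4 σ * A * (permSL (Fin 3) F4 σ)⁻¹ ∈ N :=
    mul_mem (mul_mem (permSL_mem hj ht σ) hA) (inv_mem (permSL_mem hj ht σ))
  refine eq_top_iff.2 fun M _ =>
    Matrix.SpecialLinearGroup.diagonal_transvection_induction' (· ∈ N) M ?_ ?_ fun _ _ => mul_mem
  · intro i k hik c hc
    obtain ⟨σ, rfl, rfl⟩ := exists_perm 0 2 i k (by decide) hik
    have diag_mem : diag2n (i := 0) (j := 2) (by decide) c hc ∈ N :=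
      matR_eq_diag2n (Units.mk0 c hc) ▸ matR_mem hζ hr (Units.mk0 c hc)
    rw [← permSL_conj_diag2n σ (by decide) c hc]
    exact conj_mem diag_mem
  · intro i k hik c
    obtain ⟨σ, rfl, rfl⟩ := exists_perm 0 1 i k (by decide) hik
    rw [← permSL_conj_transvection σ (by decide) c]
    exact conj_mem (transvection_zero_one_mem hζ hs hr c)

end Generation

theorem closure_genPerm {ζ : F4ˣ} (hζ : ∀ x : F4ˣ, x ∈ Subgroup.zpowers ζ) :
    Subgroup.closure (Set.range (genPerm ζ)) = M24 ζ := by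
  set N := Subgroup.closure (Set.range (genPerm ζ)) with hN
  have genPerm_mem (g : Gen) : genPerm ζ g ∈ N := Subgroup.subset_closure ⟨g, rfl⟩
  have pslHom_mem (M : PSL34) : pslHom M ∈ N := by
    have comap_eq_top := eq_top_of_generators_mem
      (N := N.comap (pslHom.comp (QuotientGroup.mk' _))) hζ (genPerm_mem .s) (genPerm_mem .j)
      (genPerm_mem .t) (genPerm_mem .r)
    obtain ⟨M, rfl⟩ := QuotientGroup.mk_surjective M
    exact comap_eq_top.ge (Subgroup.mem_top M)
  have M22_le_M23 : M22 ≤ M23 ζ := fun x hx => Subgroup.subset_closure (Or.inl hx)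
  have M23_le_M24 : M23 ζ ≤ M24 ζ := fun x hx => Subgroup.subset_closure (Or.inl hx)
  have pslHom_mem_M24 (M : PSL34) : pslHom M ∈ M24 ζ :=
    M23_le_M24 (M22_le_M23 (Subgroup.subset_closure (Or.inl ⟨M, rfl⟩)))
  have M22_le : M22 ≤ N := by
    rw [M22, Subgroup.closure_le]
    rintro _ (⟨M, rfl⟩ | rfl)
    exacts [pslHom_mem M, genPerm_mem .u]
  have M23_le : M23 ζ ≤ N := by
    rw [M23, Subgroup.closure_le]
    rintro _ (hx | rfl)
    exacts [M22_le hx, genPerm_mem .v]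
  apply le_antisymm
  · rw [hN, Subgroup.closure_le]
    rintro _ ⟨g | _, rfl⟩
    exacts [pslHom_mem_M24 _, pslHom_mem_M24 _, pslHom_mem_M24 _, pslHom_mem_M24 _,
      M23_le_M24 (M22_le_M23 (Subgroup.subset_closure (Or.inr rfl))),
      M23_le_M24 (Subgroup.subset_closure (Or.inr rfl)), Subgroup.subset_closure (Or.inr rfl)]
  · rw [M24, Subgroup.closure_le]
    rintro _ (hx | rfl)
    exacts [M23_le hx, genPerm_mem .w]

end Mathieu

end

/-- For every primitive element `ζ` of `GF(4)`, the permutations `𝔰, 𝔧, 𝔱, 𝔯, 𝔲, 𝔳, 𝔴` generate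
`M₂₄`, and the listed relations are defining relations for these generators. -/
theorem proposition7p7 (ζ : Mathieu.F4ˣ) (hζ : ∀ x : Mathieu.F4ˣ, x ∈ Subgroup.zpowers ζ) :
    Subgroup.closure (Set.range (Mathieu.genPerm ζ)) = Mathieu.M24 ζ ∧
      ∃ e : PresentedGroup Mathieu.relsM24 ≃* Mathieu.M24 ζ,
        ∀ g : Mathieu.Gen,
          ((e (PresentedGroup.of g) : Mathieu.M24 ζ) : Equiv.Perm Mathieu.Point24) =
            Mathieu.genPerm ζ g := by
  have closure_eq := Mathieu.closure_genPerm hζ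
  let φ := PresentedGroup.toGroup (Mathieu.rels_genPerm hζ)
  have φ_of (g : Mathieu.Gen) : φ (PresentedGroup.of g) = Mathieu.genPerm ζ g :=
    PresentedGroup.toGroup.of _
  have φ_injective : Function.Injective φ := Mathieu.toGroup_rels_genPerm_injective hζ
  have range_φ : φ.range = Mathieu.M24 ζ := by
    rw [← closure_eq, MonoidHom.range_eq_map, ← PresentedGroup.closure_range_of,
      MonoidHom.map_closure, ← Set.range_comp]
    exact congrArg (Subgroup.closure ∘ Set.range) (funext φ_of)
  exact ⟨closure_eq, (MonoidHom.ofInjective φ_injective).trans (MulEquiv.subgroupCongr range_φ),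
    φ_of⟩
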